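/- Let $M$ be a compact complex surface (a compact Hausdorff complex manifold of complex dimension $2$) with a smooth Hermitian metric $g$. Write $g_{i\bar j}=g(\partial_{z_i},\partial_{\bar z_j})$ in holomorphic coordinates, let $$R_{i\bar jk\bar l}=-\frac{\partial^2 g_{k\bar l}}{\partial z_i\partial\bar z_j}+g^{p\bar q}\frac{\partial g_{k\bar q}}{\partial z_i}\frac{\partial g_{p\bar l}}{\partial\bar z_j}$$ be the curvature of the Chern connection, and let $$Ric^{(1)}_{i\bar j}=g^{k\bar l}R_{i\bar jk\bar l},\quad Ric^{(2)}_{k\bar l}=g^{i\bar j}R_{i\bar jk\bar l},\quad Ric^{(3)}_{i\bar l}=g^{k\bar j}R_{i\bar jk\bar l},\quad Ric^{(4)}_{k\bar j}=g^{i\bar l}R_{i\bar jk\bar l}$$ be its four Ricci traces. For a nonzero $(1,0)$-vector $X$ let $H(X)=R(X,\bar X,X,\bar X)/|X|^4$, and for $k\in\{1,2,3,4\}$ and $\alpha,\beta\in\mathbb R$ let $$\mathcal C^{(k)}_{\alpha,\beta}(X)=\frac{\alpha}{|X|^2}Ric^{(k)}(X,\bar X)+\beta H(X)$$ be the $k$th-mixed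 curvature (a complex number in general). **Theorem.** Let $k\in\{1,2,3,4\}$, $\alpha,\beta\in\mathbb R$ with $\beta\neq0$, and suppose that there is a constant $c$ (real or complex) such that $\mathcal C^{(k)}_{\alpha,\beta}(X)=c$ for every nonzero $(1,0)$-vector $X$ at every point of $M$. Then $g$ is self-dual: the anti-self-dual part $W^-$ of the Weyl tensor of the underlying Riemannian metric, with respect to the orientation given by the complex structure, vanishes identically. -/

import Mathlib

open scoped Manifold ContDiff

/-- The model space `ℂ²`. -/
abbrev C2 : Type := EuclideanSpace ℂ (Fin 2)

/-- A complex surface is also a real analytic (hence smooth) manifold modelled on `ℂ²`, seen as a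
real vector space. -/
instance realManifoldOfComplexSurface {M : Type*} [TopologicalSpace M] [ChartedSpace C2 M]
    [IsManifold 𝓘(ℂ, C2) ω M] : IsManifold 𝓘(ℝ, C2) ω M := by
  apply isManifold_of_contDiffOn
  intro e e' he he'
  have h := (contDiffGroupoid ω 𝓘(ℂ, C2)).compatible he he'
  rw [contDiffGroupoid, mem_groupoid_of_pregroupoid] at h
  have h1 : ContDiffOn ℂ ω
      (𝓘(ℂ, C2) ∘ (e.symm ≫ₕ e') ∘ 𝓘(ℂ, C2).symm)
      (𝓘(ℂ, C2).symm ⁻¹' (e.symm ≫ₕ e').source ∩ Set.range 𝓘(ℂ, C2)) := h.1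
  exact h1.restrict_scalars ℝ

/-- A Hermitian metric on a complex surface: a smooth Riemannian metric on the (real) tangent
bundle for which the complex structure `J` (multiplication by `i`) is orthogonal. -/
structure HermitianMetric (M : Type*) [TopologicalSpace M] [ChartedSpace C2 M]
    [IsManifold 𝓘(ℂ, C2) ω M] extends
    Bundle.ContMDiffRiemannianMetric 𝓘(ℝ, C2) ∞ C2
      (fun x : M ↦ TangentSpace 𝓘(ℝ, C2) x) where
  inner_J : ∀ (x : M) (v w : C2),
    inner x (Complex.I • v : C2) (Complex.I • w : C2) = inner x v w

namespace HermitianMetric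

noncomputable section

variable {M : Type*} [TopologicalSpace M] [ChartedSpace C2 M] [IsManifold 𝓘(ℂ, C2) ω M]

/-- The coordinate vector `∂/∂xᵢ` of `ℂ²`, where `zᵢ = xᵢ + √-1 yᵢ`. -/
def ex (i : Fin 2) : C2 := EuclideanSpace.single i 1

/-- The coordinate vector `∂/∂yᵢ = J ∂/∂xᵢ` of `ℂ²`. -/
def ey (i : Fin 2) : C2 := EuclideanSpace.single i Complex.I

/-- The positively oriented real basis `∂/∂x₁, ∂/∂y₁, ∂/∂x₂, ∂/∂y₂` of `ℂ²`. -/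
def realBasis : Fin 4 → C2 := ![ex 0, ey 0, ex 1, ey 1]

/-- The metric `g` read in the preferred holomorphic chart `φ` at `x`: the value at the point
`z` of `ℂ²` on the vectors `v`, `w` is `g (dφ⁻¹ v) (dφ⁻¹ w)` at `φ⁻¹ z`. All curvatures at `x` are
computed in this chart, which is also the chart by which a tangent vector at `x` is an element of
`ℂ²`. -/
def localMetric (g : HermitianMetric M) (x : M) (z v w : C2) : ℝ :=
  g.inner ((chartAt C2 x).symm z)
    (mfderiv 𝓘(ℝ, C2) 𝓘(ℝ, C2) (chartAt C2 x).symm z v)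
    (mfderiv 𝓘(ℝ, C2) 𝓘(ℝ, C2) (chartAt C2 x).symm z w)

/-! ### Chern curvature -/

/-- The components `g_{i j̄} = g(∂/∂zᵢ, ∂/∂z̄ⱼ)` of the complex bilinear extension of the metric,
where `∂/∂z = (∂/∂x - √-1 ∂/∂y) / 2` and `∂/∂z̄ = (∂/∂x + √-1 ∂/∂y) / 2`. -/
def hermMatrix (g : HermitianMetric M) (x : M) (z : C2) : Matrix (Fin 2) (Fin 2) ℂ :=
  Matrix.of fun i j ↦
    (1 / 4 : ℂ) * ((g.localMetric x z (ex i) (ex j) : ℂ)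
      + Complex.I * (g.localMetric x z (ex i) (ey j) : ℂ)
      - Complex.I * (g.localMetric x z (ey i) (ex j) : ℂ)
      + (g.localMetric x z (ey i) (ey j) : ℂ))

/-- The Wirtinger derivative `∂f/∂zᵢ`. -/
def dz (i : Fin 2) (f : C2 → ℂ) (z : C2) : ℂ :=
  (1 / 2 : ℂ) * (fderiv ℝ f z (ex i) - Complex.I * fderiv ℝ f z (ey i))

/-- The Wirtinger derivative `∂f/∂z̄ᵢ`. -/
def dzbar (i : Fin 2) (f : C2 → ℂ) (z : C2) : ℂ :=
  (1 / 2 : ℂ) * (fderiv ℝ f z (ex i) + Complex.I * fderiv ℝ f z (ey i))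

/-- The inverse metric `g^{p q̄}` at `x`, with `∑ q, g^{p q̄} g_{k q̄} = δ_{pk}`. -/
def hermInv (g : HermitianMetric M) (x : M) (p q : Fin 2) : ℂ :=
  (g.hermMatrix x (chartAt C2 x x))⁻¹ q p

/-- The components `R_{i j̄ k l̄} = -∂ᵢ∂_{j̄} g_{k l̄} + g^{p q̄} ∂ᵢ g_{k q̄} ∂_{j̄} g_{p l̄}` at `x` of the
curvature of the Chern connection. -/
def chernCurv (g : HermitianMetric M) (x : M) (i j k l : Fin 2) : ℂ :=
  - dz i (fun z ↦ dzbar j (fun z' ↦ g.hermMatrix x z' k l) z) (chartAt C2 x x)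
    + ∑ p, ∑ q, g.hermInv x p q
        * dz i (fun z ↦ g.hermMatrix x z k q) (chartAt C2 x x)
        * dzbar j (fun z ↦ g.hermMatrix x z p l) (chartAt C2 x x)

/-- The components of the `k`th Chern Ricci curvature, `k = 1, 2, 3, 4`:
`Ric⁽¹⁾_{a b̄} = g^{k l̄} R_{a b̄ k l̄}`, `Ric⁽²⁾_{a b̄} = g^{i j̄} R_{i j̄ a b̄}`,
`Ric⁽³⁾_{a b̄} = g^{k j̄} R_{a j̄ k b̄}`, `Ric⁽⁴⁾_{a b̄} = g^{i l̄} R_{i b̄ a l̄}`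
(and `0` for the other, meaningless, values of `k`). -/
def chernRicci (g : HermitianMetric M) (k : ℕ) (x : M) (a b : Fin 2) : ℂ :=
  match k with
  | 1 => ∑ p, ∑ q, g.hermInv x p q * g.chernCurv x a b p q
  | 2 => ∑ p, ∑ q, g.hermInv x p q * g.chernCurv x p q a b
  | 3 => ∑ p, ∑ q, g.hermInv x p q * g.chernCurv x a q p b
  | 4 => ∑ p, ∑ q, g.hermInv x p q * g.chernCurv x p b a q
  | _ => 0

/-- `|X|² = g_{i j̄} Xⁱ X̄ʲ` for the (1,0)-vector `X = Xⁱ ∂/∂zᵢ` at `x`. -/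
def normSq (g : HermitianMetric M) (x : M) (X : C2) : ℂ :=
  ∑ i, ∑ j, g.hermMatrix x (chartAt C2 x x) i j * X i * star (X j)

/-- `Ric⁽ᵏ⁾(X, X̄)` for the (1,0)-vector `X = Xⁱ ∂/∂zᵢ` at `x`. -/
def ricciForm (g : HermitianMetric M) (k : ℕ) (x : M) (X : C2) : ℂ :=
  ∑ i, ∑ j, g.chernRicci k x i j * X i * star (X j)

/-- The holomorphic sectional curvature `H(X) = R(X, X̄, X, X̄) / |X|⁴` of the Chern connection. -/
def holSecCurv (g : HermitianMetric M) (x : M) (X : C2) : ℂ :=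
  (∑ i, ∑ j, ∑ k, ∑ l, g.chernCurv x i j k l * X i * star (X j) * X k * star (X l))
    / g.normSq x X ^ 2

/-- The `k`th-mixed curvature `C⁽ᵏ⁾_{α,β}(X) = (α / |X|²) Ric⁽ᵏ⁾(X, X̄) + β H(X)`. It is
complex-valued, since `Ric⁽³⁾` and `Ric⁽⁴⁾` need not be Hermitian forms. -/
def mixedCurv (g : HermitianMetric M) (k : ℕ) (α β : ℝ) (x : M) (X : C2) : ℂ :=
  (α : ℂ) / g.normSq x X * g.ricciForm k x X + (β : ℂ) * g.holSecCurv x X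

/-! ### Riemannian curvature, Weyl tensor and self-duality

Indices `a, b, c, …` in `Fin 4` refer to the real coordinates `x₁, y₁, x₂, y₂`. -/

/-- The components `g_{ab}` of the underlying Riemannian metric. -/
def realMatrix (g : HermitianMetric M) (x : M) (z : C2) : Matrix (Fin 4) (Fin 4) ℝ :=
  Matrix.of fun a b ↦ g.localMetric x z (realBasis a) (realBasis b)

/-- The partial derivative of `f` in the direction of the `a`th real coordinate. -/
def pd (a : Fin 4) (f : C2 → ℝ) (z : C2) : ℝ := fderiv ℝ f z (realBasis a)

/-- The Christoffel symbols
`Γᶜ_{ab} = g^{cd} (∂ₐ g_{bd} + ∂_b g_{ad} - ∂_d g_{ab}) / 2` of the Levi-Civita connection. -/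
def christoffel (g : HermitianMetric M) (x : M) (c a b : Fin 4) (z : C2) : ℝ :=
  (1 / 2 : ℝ) * ∑ d, (g.realMatrix x z)⁻¹ c d *
    (pd a (fun z' ↦ g.realMatrix x z' b d) z + pd b (fun z' ↦ g.realMatrix x z' a d) z
      - pd d (fun z' ↦ g.realMatrix x z' a b) z)

/-- The components `Rᵉ_{bcd}` of the Riemann curvature tensor at `x`:
`R(∂_c, ∂_d) ∂_b = Rᵉ_{bcd} ∂_e`. -/
def riemannUp (g : HermitianMetric M) (x : M) (e b c d : Fin 4) : ℝ :=
  pd c (g.christoffel x e d b) (chartAt C2 x x) - pd d (g.christoffel x e c b) (chartAt C2 x x)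
    + ∑ f, (g.christoffel x e c f (chartAt C2 x x) * g.christoffel x f d b (chartAt C2 x x)
      - g.christoffel x e d f (chartAt C2 x x) * g.christoffel x f c b (chartAt C2 x x))

/-- The metric `g_{ab}` at `x`. -/
def gDown (g : HermitianMetric M) (x : M) (a b : Fin 4) : ℝ :=
  g.realMatrix x (chartAt C2 x x) a b

/-- The inverse metric `g^{ab}` at `x`. -/
def gUp (g : HermitianMetric M) (x : M) (a b : Fin 4) : ℝ :=
  (g.realMatrix x (chartAt C2 x x))⁻¹ a b

/-- The Riemann curvature tensor `R_{abcd} = g_{ae} Rᵉ_{bcd}` at `x`. -/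
def riemann (g : HermitianMetric M) (x : M) (a b c d : Fin 4) : ℝ :=
  ∑ e, g.gDown x a e * g.riemannUp x e b c d

/-- The Riemannian Ricci tensor `R_{bd} = Rᶜ_{bcd}` at `x`. -/
def ricci (g : HermitianMetric M) (x : M) (b d : Fin 4) : ℝ :=
  ∑ c, g.riemannUp x c b c d

/-- The Riemannian scalar curvature `s = g^{bd} R_{bd}` at `x`. -/
def scalarCurv (g : HermitianMetric M) (x : M) : ℝ :=
  ∑ b, ∑ d, g.gUp x b d * g.ricci x b d

/-- The Weyl tensor `W_{abcd}` at `x`, in real dimension four. -/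
def weyl (g : HermitianMetric M) (x : M) (a b c d : Fin 4) : ℝ :=
  g.riemann x a b c d
    - (1 / 2 : ℝ) * (g.gDown x a c * g.ricci x b d - g.gDown x a d * g.ricci x b c
        - g.gDown x b c * g.ricci x a d + g.gDown x b d * g.ricci x a c)
    + g.scalarCurv x / 6 * (g.gDown x a c * g.gDown x b d - g.gDown x a d * g.gDown x b c)

/-- The Levi-Civita symbol on four indices: the sign of `(a, b, c, d)` as a permutation of
`(0, 1, 2, 3)`, and `0` if two of the indices coincide. -/
def leviCivita (a b c d : Fin 4) : ℝ :=
  Matrix.det (Matrix.of fun i j : Fin 4 ↦ if ![a, b, c, d] i = j then (1 : ℝ) else 0)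

/-- The volume form `√(det g) ε_{abcd}` at `x`, for the orientation given by the complex
structure, in which `∂/∂x₁, ∂/∂y₁, ∂/∂x₂, ∂/∂y₂` is positive. -/
def volForm (g : HermitianMetric M) (x : M) (a b c d : Fin 4) : ℝ :=
  Real.sqrt (g.realMatrix x (chartAt C2 x x)).det * leviCivita a b c d

/-- The Hodge star operator on 2-forms at `x`: `(⋆η)_{ab} = (1/2) vol_{abpq} g^{pe} g^{qf} η_{ef}`. -/
def hodgeStar (g : HermitianMetric M) (x : M) (η : Fin 4 → Fin 4 → ℝ) (a b : Fin 4) : ℝ :=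
  (1 / 2 : ℝ) * ∑ p, ∑ q, ∑ e, ∑ f,
    g.volForm x a b p q * g.gUp x p e * g.gUp x q f * η e f

/-- The anti-self-dual part `W⁻ = (W - ⋆W) / 2` of the Weyl tensor at `x`. The star acts on the
first pair of indices; `W` commutes with `⋆`, so that this is the restriction of the Weyl operator
to the `(-1)`-eigenspace of `⋆` on 2-forms, extended by zero to the `(+1)`-eigenspace. -/
def weylMinus (g : HermitianMetric M) (x : M) (a b c d : Fin 4) : ℝ :=
  (1 / 2 : ℝ) * (g.weyl x a b c d - g.hodgeStar x (fun e f ↦ g.weyl x e f c d) a b)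

/-- A Hermitian metric on a complex surface is self-dual if `W⁻ = 0` everywhere. -/
def IsSelfDual (g : HermitianMetric M) : Prop :=
  ∀ (x : M) (a b c d : Fin 4), g.weylMinus x a b c d = 0

end

end HermitianMetric

/-!
The statement is pointwise: at every point `x`, constancy of the mixed curvature on the tangent
space at `x` forces `W⁻ = 0` at `x`.

For a unitary frame `X`, `Y` of `(1, 0)`-vectors, the 2-vectors `X ∧ Ȳ` are, as the frame varies,
the null vectors of the complexification of `Λ⁻`. A trace-free symmetric form on a
three-dimensional space that vanishes on all null vectors is zero; so `W⁻ = 0` if and only if the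
Levi-Civita curvature satisfies `R(X, Ȳ, X, Ȳ) = 0` for all unitary frames.

This component of the curvature is the same, up to sign convention, for the Levi-Civita and for the
Chern connection (`IsUnitaryFrame.curv_eq_chernForm`): the second derivatives of the metric that
enter are the same, one product of Christoffel symbols is the quadratic term of the Chern curvature,
and the other product, which carries the torsion, is a sum of two terms each having a zero factor.

It remains to see that `R(X, Ȳ, X, Ȳ) = 0` for the Chern curvature. Since `β ≠ 0`, the hypothesis
writes the quartic form `R(X, X̄, X, X̄)` as the product of `|X|²` and of a sesquilinear form,
namely `(c |X|² - α Ric(X, X̄)) / β`. Replacing `X` by `X + t Y` with `Y ⊥ X` and `|t| = 1`, the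
right-hand side has no component of weight `±2` in `t`, hence `R(Y, X̄, Y, X̄) = R(X, Ȳ, X, Ȳ) = 0`
(`quad_eq_zero`, `IsUnitaryFrame.chernForm_eq_zero`). Of the Ricci term, only its sesquilinearity
enters, which all four traces share.

For the passage from null vectors to `W⁻`, three unitary frames are enough: `(u, v)`,
`(u + v, v - u)` and `(u + iv, v + iu)` show that the curvature operator, compressed to `Λ⁻`, is a
multiple of the identity (`IsUnitaryFrame.isScalarOnMinus`). Linear algebra in an orthonormal frame
gives `W = ⋆W` (`frameWeyl_eq_star`), and
`IsUnitaryFrame.weylMinus_eq_zero` carries this back to the coordinate components.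
-/

namespace HermitianMetric

noncomputable section

set_option maxSynthPendingDepth 3

variable {M : Type*} [TopologicalSpace M] [ChartedSpace C2 M] [IsManifold 𝓘(ℂ, C2) ω M]

/-! ### The metric in a holomorphic chart -/

/-- The metric in the preferred chart at `x`, as a field of continuous bilinear forms on `ℂ²`. -/
def metricForm (g : HermitianMetric M) (x : M) (z : C2) : C2 →L[ℝ] C2 →L[ℝ] ℝ :=
  let L : C2 →L[ℝ] C2 := mfderiv 𝓘(ℝ, C2) 𝓘(ℝ, C2) (chartAt C2 x).symm z
  ContinuousLinearMap.bilinearComp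
    (g.inner ((chartAt C2 x).symm z) : C2 →L[ℝ] C2 →L[ℝ] ℝ) L L

theorem metricForm_apply (g : HermitianMetric M) (x : M) (z v w : C2) :
    g.metricForm x z v w = g.localMetric x z v w := rfl

theorem metricForm_symm (g : HermitianMetric M) (x : M) (z v w : C2) :
    g.metricForm x z v w = g.metricForm x z w v := g.symm _ _ _

/-- The real differential of the inverse of the preferred chart at `x`, as a linear map of `ℂ²`. -/
def chartDeriv (x : M) (z : C2) : C2 →L[ℝ] C2 :=
  mfderiv 𝓘(ℝ, C2) 𝓘(ℝ, C2) (chartAt C2 x).symm z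

/-- The real differential of a holomorphic chart is complex linear. -/
theorem chartDeriv_smul_I (x : M) {z : C2} (hz : z ∈ (chartAt C2 x).target) (v : C2) :
    chartDeriv x z (Complex.I • v) = Complex.I • chartDeriv x z v := by
  have h1 : MDifferentiableAt 𝓘(ℂ, C2) 𝓘(ℂ, C2) (chartAt C2 x).symm z :=
    (((contMDiffOn_chart_symm (I := 𝓘(ℂ, C2)) (n := ω) (x := x)) z hz).contMDiffAt
      ((chartAt C2 x).open_target.mem_nhds hz)).mdifferentiableAt (by simp)
  have h2 : MDifferentiableAt 𝓘(ℝ, C2) 𝓘(ℝ, C2) (chartAt C2 x).symm z :=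
    (((contMDiffOn_chart_symm (I := 𝓘(ℝ, C2)) (n := ω) (x := x)) z hz).contMDiffAt
      ((chartAt C2 x).open_target.mem_nhds hz)).mdifferentiableAt (by simp)
  have h3 : DifferentiableAt ℂ
      (writtenInExtChartAt 𝓘(ℂ, C2) 𝓘(ℂ, C2) z (chartAt C2 x).symm) z := by
    have h := h1.differentiableWithinAt_writtenInExtChartAt
    rw [modelWithCornersSelf_coe, Set.range_id] at h
    exact differentiableWithinAt_univ.1 h
  have key : chartDeriv x z =
      (fderiv ℂ (writtenInExtChartAt 𝓘(ℂ, C2) 𝓘(ℂ, C2) z (chartAt C2 x).symm) z).restrictScalars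
        ℝ := by
    rw [← h3.fderiv_restrictScalars ℝ, chartDeriv, h2.mfderiv]
    simp only [modelWithCornersSelf_coe, Set.range_id, fderivWithin_univ]
    rfl
  rw [key]
  exact (fderiv ℂ (writtenInExtChartAt 𝓘(ℂ, C2) 𝓘(ℂ, C2) z (chartAt C2 x).symm) z).map_smul _ _

theorem metricForm_smul_I (g : HermitianMetric M) (x : M) {z : C2}
    (hz : z ∈ (chartAt C2 x).target) (v w : C2) :
    g.metricForm x z (Complex.I • v) (Complex.I • w) = g.metricForm x z v w := by
  change g.inner _ (chartDeriv x z _) (chartDeriv x z _) = _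
  rw [chartDeriv_smul_I x hz, chartDeriv_smul_I x hz]
  exact g.inner_J _ _ _

/-- Positivity in the chart: the differential of the inverse chart is injective. -/
theorem metricForm_pos (g : HermitianMetric M) (x : M) {z : C2}
    (hz : z ∈ (chartAt C2 x).target) {v : C2} (hv : v ≠ 0) :
    0 < g.metricForm x z v v := by
  apply g.pos
  intro h
  apply hv
  have h2 : MDifferentiableAt 𝓘(ℝ, C2) 𝓘(ℝ, C2) (chartAt C2 x).symm z :=
    (((contMDiffOn_chart_symm (I := 𝓘(ℝ, C2)) (n := ω) (x := x)) z hz).contMDiffAt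
      ((chartAt C2 x).open_target.mem_nhds hz)).mdifferentiableAt (by simp)
  have h4 : MDifferentiableAt 𝓘(ℝ, C2) 𝓘(ℝ, C2) (chartAt C2 x) ((chartAt C2 x).symm z) :=
    (((contMDiffOn_chart (I := 𝓘(ℝ, C2)) (n := ω) (x := x)) _
      ((chartAt C2 x).map_target hz)).contMDiffAt
      ((chartAt C2 x).open_source.mem_nhds
        ((chartAt C2 x).map_target hz))).mdifferentiableAt (by simp)
  have h5 : mfderiv 𝓘(ℝ, C2) 𝓘(ℝ, C2) ((chartAt C2 x) ∘ (chartAt C2 x).symm) z =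
      ContinuousLinearMap.id ℝ C2 := by
    have : ((chartAt C2 x) ∘ (chartAt C2 x).symm) =ᶠ[nhds z] id := by
      filter_upwards [(chartAt C2 x).open_target.mem_nhds hz] with y hy
      exact (chartAt C2 x).right_inv hy
    rw [this.mfderiv_eq]
    exact mfderiv_id
  rw [mfderiv_comp z h4 h2] at h5
  have h6 := congrArg (fun L : C2 →L[ℝ] C2 => L v) h5
  have h7 : (mfderiv 𝓘(ℝ, C2) 𝓘(ℝ, C2) (chartAt C2 x) ((chartAt C2 x).symm z))
     (mfderiv 𝓘(ℝ, C2) 𝓘(ℝ, C2) (chartAt C2 x).symm z v) = v := h6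
  rw [← h7]
  erw [h]
  exact map_zero _

/-- Smoothness of the metric as a section of a bundle gives smoothness in the chart: `∂φ⁻¹(v)` is a
smooth section along `φ⁻¹`, because the tangent map of `φ⁻¹` is smooth. -/
theorem contDiffAt_metricForm (g : HermitianMetric M) (x : M) {z : C2}
    (hz : z ∈ (chartAt C2 x).target) : ContDiffAt ℝ ∞ (g.metricForm x) z := by
  suffices h : ∀ v w, ContDiffOn ℝ ∞ (fun z => g.metricForm x z v w) (chartAt C2 x).target from
    (contDiffOn_clm_apply.2 fun v => contDiffOn_clm_apply.2 fun w => h v w).contDiffAt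
      ((chartAt C2 x).open_target.mem_nhds hz)
  clear hz z
  intro v w z hz
  apply ContDiffAt.contDiffWithinAt
  have hU := (chartAt C2 x).open_target.mem_nhds hz
  have hs := contMDiffOn_chart_symm (I := 𝓘(ℝ, C2)) (n := ω) (x := x)
  have hs' : ContMDiffOn 𝓘(ℝ, C2) 𝓘(ℝ, C2) ∞ (chartAt C2 x).symm (chartAt C2 x).target :=
    hs.of_le le_top
  have hvec : ∀ v : C2, ContMDiffAt 𝓘(ℝ, C2) (𝓘(ℝ, C2).prod 𝓘(ℝ, C2)) ∞
      (fun z => (Bundle.TotalSpace.mk' C2 ((chartAt C2 x).symm z)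
        (mfderiv 𝓘(ℝ, C2) 𝓘(ℝ, C2) (chartAt C2 x).symm z v) : TangentBundle 𝓘(ℝ, C2) M)) z := by
    intro v
    have hc : ContMDiffAt 𝓘(ℝ, C2) (𝓘(ℝ, C2).prod 𝓘(ℝ, C2)) ∞
        (fun y : C2 => (Bundle.TotalSpace.mk' C2 y v : TangentBundle 𝓘(ℝ, C2) C2)) z := by
      have := (contMDiffWithinAt_vectorSpace_iff_contDiffWithinAt (𝕜 := ℝ) (n := ∞)
        (V := fun _ : C2 => v) (s := Set.univ) (x := z)).2 contDiffWithinAt_const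
      exact this
    have ht : ContMDiffAt 𝓘(ℝ, C2).tangent 𝓘(ℝ, C2).tangent ∞
        (tangentMapWithin 𝓘(ℝ, C2) 𝓘(ℝ, C2) (chartAt C2 x).symm (chartAt C2 x).target)
        (Bundle.TotalSpace.mk' C2 z v : TangentBundle 𝓘(ℝ, C2) C2) :=
      (hs'.contMDiffOn_tangentMapWithin (m := ∞) (by simp)
        (chartAt C2 x).open_target.uniqueMDiffOn).contMDiffAt
        (((chartAt C2 x).open_target.preimage (FiberBundle.continuous_proj C2
          (TangentSpace 𝓘(ℝ, C2)))).mem_nhds hz)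
    have h := ht.comp z hc
    refine h.congr_of_eventuallyEq ?_
    filter_upwards [hU] with y hy
    simp only [Function.comp, tangentMapWithin]
    rw [mfderivWithin_of_isOpen (chartAt C2 x).open_target hy]
  have hg : ContMDiffAt 𝓘(ℝ, C2) (𝓘(ℝ, C2).prod 𝓘(ℝ, C2 →L[ℝ] C2 →L[ℝ] ℝ)) ∞
      (fun z => (Bundle.TotalSpace.mk' (C2 →L[ℝ] C2 →L[ℝ] ℝ) ((chartAt C2 x).symm z)
        (g.inner ((chartAt C2 x).symm z)) : Bundle.TotalSpace (C2 →L[ℝ] C2 →L[ℝ] ℝ)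
         fun b : M => TangentSpace 𝓘(ℝ, C2) b →L[ℝ] TangentSpace 𝓘(ℝ, C2) b →L[ℝ] ℝ)) z :=
    (g.contMDiff.contMDiffAt).comp z (hs'.contMDiffAt hU)
  have := (ContMDiffAt.clm_bundle_apply₂ (F₃ := ℝ) (E₃ := Bundle.Trivial M ℝ) hg (hvec v) (hvec w))
  rw [Bundle.contMDiffAt_totalSpace] at this
  exact this.2.contDiffAt

/-! ### Derivatives of the metric -/

/-- The first derivatives `∂_w g(u, v)` of the metric at the chart point `z`, as a function of
`w`, `u`, `v`. -/
def metricD1 (g : HermitianMetric M) (x : M) (z : C2) : C2 →L[ℝ] C2 →L[ℝ] C2 →L[ℝ] ℝ :=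
  fderiv ℝ (g.metricForm x) z

/-- The second derivatives `∂_a ∂_b g(u, v)` of the metric at the chart point `z`, as a function of
`a`, `b`, `u`, `v`. -/
def metricD2 (g : HermitianMetric M) (x : M) (z : C2) :
    C2 →L[ℝ] C2 →L[ℝ] C2 →L[ℝ] C2 →L[ℝ] ℝ :=
  fderiv ℝ (g.metricD1 x) z

theorem differentiableAt_metricForm (g : HermitianMetric M) (x : M) {z : C2}
    (hz : z ∈ (chartAt C2 x).target) : DifferentiableAt ℝ (g.metricForm x) z :=
  (g.contDiffAt_metricForm x hz).differentiableAt (by simp)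

theorem differentiableAt_metricD1 (g : HermitianMetric M) (x : M) {z : C2}
    (hz : z ∈ (chartAt C2 x).target) : DifferentiableAt ℝ (g.metricD1 x) z :=
  ((g.contDiffAt_metricForm x hz).fderiv_right (m := ∞) (by simp)).differentiableAt (by simp)

theorem hasFDerivAt_metricForm (g : HermitianMetric M) (x : M) {z : C2}
    (hz : z ∈ (chartAt C2 x).target) (u v : C2) :
    HasFDerivAt (fun y => g.metricForm x y u v)
      (((g.metricD1 x z).flip u).flip v) z := by
  have h := (g.differentiableAt_metricForm x hz).hasFDerivAt
  have h1 := h.clm_apply (hasFDerivAt_const u z)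
  have h2 := h1.clm_apply (hasFDerivAt_const v z)
  refine h2.congr_fderiv ?_
  ext w
  simp [metricD1]

theorem hasFDerivAt_metricD1 (g : HermitianMetric M) (x : M) {z : C2}
    (hz : z ∈ (chartAt C2 x).target) (w u v : C2) :
    HasFDerivAt (fun y => g.metricD1 x y w u v)
      ((((g.metricD2 x z).flip w).flip u).flip v) z := by
  have h := (g.differentiableAt_metricD1 x hz).hasFDerivAt
  have h1 := h.clm_apply (hasFDerivAt_const w z)
  have h2 := h1.clm_apply (hasFDerivAt_const u z)
  have h3 := h2.clm_apply (hasFDerivAt_const v z)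
  refine h3.congr_fderiv ?_
  ext w
  simp [metricD2]

/-- An algebraic identity of the metric at all points of the chart is inherited by its derivatives.
-/
theorem metricD1_congr (g : HermitianMetric M) (x : M) {u v u' v' : C2}
    (h : ∀ z ∈ (chartAt C2 x).target, g.metricForm x z u v = g.metricForm x z u' v')
    {z : C2} (hz : z ∈ (chartAt C2 x).target) (w : C2) :
    g.metricD1 x z w u v = g.metricD1 x z w u' v' := by
  have h1 : HasFDerivAt (fun y => g.metricForm x y u v) (((g.metricD1 x z).flip u').flip v') z :=
    (g.hasFDerivAt_metricForm x hz u' v').congr_of_eventuallyEq (by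
      filter_upwards [(chartAt C2 x).open_target.mem_nhds hz] with y hy using h y hy)
  exact congrArg (fun L : C2 →L[ℝ] ℝ => L w) ((g.hasFDerivAt_metricForm x hz u v).unique h1)

theorem metricD2_congr (g : HermitianMetric M) (x : M) {u v u' v' : C2}
    (h : ∀ z ∈ (chartAt C2 x).target, g.metricForm x z u v = g.metricForm x z u' v')
    {z : C2} (hz : z ∈ (chartAt C2 x).target) (a b : C2) :
    g.metricD2 x z a b u v = g.metricD2 x z a b u' v' := by
  have h1 : HasFDerivAt (fun y => g.metricD1 x y b u v)
      ((((g.metricD2 x z).flip b).flip u').flip v') z :=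
    (g.hasFDerivAt_metricD1 x hz b u' v').congr_of_eventuallyEq (by
      filter_upwards [(chartAt C2 x).open_target.mem_nhds hz] with y hy
        using g.metricD1_congr x h hy b)
  exact congrArg (fun L : C2 →L[ℝ] ℝ => L a) ((g.hasFDerivAt_metricD1 x hz b u v).unique h1)

theorem metricD1_symm (g : HermitianMetric M) (x : M) {z : C2}
    (hz : z ∈ (chartAt C2 x).target) (w u v : C2) :
    g.metricD1 x z w u v = g.metricD1 x z w v u :=
  g.metricD1_congr x (fun _ _ => g.metricForm_symm x _ _ _) hz w

theorem metricD2_symm (g : HermitianMetric M) (x : M) {z : C2}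
    (hz : z ∈ (chartAt C2 x).target) (a b u v : C2) :
    g.metricD2 x z a b u v = g.metricD2 x z a b v u :=
  g.metricD2_congr x (fun _ _ => g.metricForm_symm x _ _ _) hz a b

theorem metricD1_smul_I (g : HermitianMetric M) (x : M) {z : C2}
    (hz : z ∈ (chartAt C2 x).target) (w u v : C2) :
    g.metricD1 x z w (Complex.I • u) (Complex.I • v) = g.metricD1 x z w u v :=
  g.metricD1_congr x (fun _ hy => g.metricForm_smul_I x hy _ _) hz w

theorem metricD2_smul_I (g : HermitianMetric M) (x : M) {z : C2}
    (hz : z ∈ (chartAt C2 x).target) (a b u v : C2) :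
    g.metricD2 x z a b (Complex.I • u) (Complex.I • v) = g.metricD2 x z a b u v :=
  g.metricD2_congr x (fun _ hy => g.metricForm_smul_I x hy _ _) hz a b

theorem metricD2_comm (g : HermitianMetric M) (x : M) {z : C2}
    (hz : z ∈ (chartAt C2 x).target) (a b u v : C2) :
    g.metricD2 x z a b u v = g.metricD2 x z b a u v := by
  have h : IsSymmSndFDerivAt ℝ (g.metricForm x) z :=
    (g.contDiffAt_metricForm x hz).isSymmSndFDerivAt (by
      simpa using WithTop.coe_le_coe.2 (le_top : (2 : ℕ∞) ≤ ⊤))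
  have := h.eq a b
  exact congrArg (fun L : C2 →L[ℝ] C2 →L[ℝ] ℝ => L u v) this

/-! ### The Levi-Civita connection and the curvature with lowered indices -/

/-- The Christoffel symbols of the first kind
`Γ(w; u, v) = (∂_u g(v, w) + ∂_v g(u, w) - ∂_w g(u, v)) / 2`. -/
def christoffelLow (g : HermitianMetric M) (x : M) (z w u v : C2) : ℝ :=
  (1 / 2 : ℝ) * (g.metricD1 x z u v w + g.metricD1 x z v u w - g.metricD1 x z w u v)

theorem pd_realMatrix (g : HermitianMetric M) (x : M) {z : C2}
    (hz : z ∈ (chartAt C2 x).target) (a b c : Fin 4) :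
    pd a (fun y => g.realMatrix x y b c) z =
      g.metricD1 x z (realBasis a) (realBasis b) (realBasis c) :=
  congrArg (fun L : C2 →L[ℝ] ℝ => L (realBasis a))
    (g.hasFDerivAt_metricForm x hz (realBasis b) (realBasis c)).fderiv

theorem christoffel_eq (g : HermitianMetric M) (x : M) {z : C2}
    (hz : z ∈ (chartAt C2 x).target) (c a b : Fin 4) :
    g.christoffel x c a b z = ∑ d, (g.realMatrix x z)⁻¹ c d *
      g.christoffelLow x z (realBasis d) (realBasis a) (realBasis b) := by
  simp only [christoffel, g.pd_realMatrix x hz, christoffelLow, Finset.mul_sum]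
  refine Finset.sum_congr rfl fun d _ => ?_
  ring

theorem realBasis_eq_zero {t : Fin 4 → ℝ} (h : ∑ a, t a • realBasis a = 0) : t = 0 := by
  have h0 := congrArg (fun v : C2 => v 0) h
  have h1 := congrArg (fun v : C2 => v 1) h
  simp [Fin.sum_univ_four, realBasis, ex, ey, Complex.ext_iff] at h0 h1
  ext a
  fin_cases a <;> simp [h0, h1]

/-- The matrix inverse in the definition of the Christoffel symbols is a true inverse. -/
theorem realMatrix_isUnit_det (g : HermitianMetric M) (x : M) {z : C2}
    (hz : z ∈ (chartAt C2 x).target) : IsUnit (g.realMatrix x z).det := by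
  rw [← Matrix.isUnit_iff_isUnit_det, ← Matrix.mulVec_injective_iff_isUnit]
  refine (injective_iff_map_eq_zero (Matrix.mulVecLin (g.realMatrix x z))).2 fun t ht => ?_
  apply realBasis_eq_zero
  by_contra hv
  have hpos := g.metricForm_pos x hz hv
  have h : g.metricForm x z (∑ a, t a • realBasis a) (∑ a, t a • realBasis a)
      = ∑ a, t a * ((g.realMatrix x z).mulVec t) a := by
    simp only [map_sum, map_smul, sum_apply, smul_apply,
      smul_eq_mul, Matrix.mulVec, dotProduct]
    refine Finset.sum_congr rfl fun a _ => congrArg _ (Finset.sum_congr rfl fun b _ => ?_)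
    rw [metricForm_symm, mul_comm]
    rfl
  rw [Matrix.mulVecLin_apply] at ht
  rw [h, ht] at hpos
  simp at hpos

theorem _root_.DifferentiableAt.matrix_det {E n : Type*} [NormedAddCommGroup E] [NormedSpace ℝ E]
    [Fintype n] [DecidableEq n] {A : E → Matrix n n ℝ} {z : E}
    (h : ∀ i j, DifferentiableAt ℝ (fun y => A y i j) z) :
    DifferentiableAt ℝ (fun y => (A y).det) z := by
  simp only [Matrix.det_apply']
  fun_prop

theorem _root_.DifferentiableAt.matrix_inv {E n : Type*} [NormedAddCommGroup E] [NormedSpace ℝ E]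
    [Fintype n] [DecidableEq n] {A : E → Matrix n n ℝ} {z : E}
    (h : ∀ i j, DifferentiableAt ℝ (fun y => A y i j) z) (hz : IsUnit (A z).det) (i j : n) :
    DifferentiableAt ℝ (fun y => (A y)⁻¹ i j) z := by
  simp only [Matrix.inv_def, Ring.inverse_eq_inv', Matrix.smul_apply, smul_eq_mul,
    Matrix.adjugate_apply]
  refine ((DifferentiableAt.matrix_det h).inv hz.ne_zero).mul (DifferentiableAt.matrix_det ?_)
  intro k l
  by_cases hk : k = j
  · subst hk
    simp
  · simpa [Matrix.updateRow_ne hk] using h k l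

theorem hasFDerivAt_christoffelLow (g : HermitianMetric M) (x : M) {z : C2}
    (hz : z ∈ (chartAt C2 x).target) (w u v : C2) :
    HasFDerivAt (fun y => g.christoffelLow x y w u v)
      ((1 / 2 : ℝ) • ((((g.metricD2 x z).flip u).flip v).flip w +
        (((g.metricD2 x z).flip v).flip u).flip w -
        (((g.metricD2 x z).flip w).flip u).flip v)) z :=
  (((g.hasFDerivAt_metricD1 x hz u v w).add (g.hasFDerivAt_metricD1 x hz v u w)).sub
    (g.hasFDerivAt_metricD1 x hz w u v)).const_mul _

theorem differentiableAt_christoffel (g : HermitianMetric M) (x : M) {z : C2}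
    (hz : z ∈ (chartAt C2 x).target) (c a b : Fin 4) :
    DifferentiableAt ℝ (g.christoffel x c a b) z := by
  have h : DifferentiableAt ℝ (fun y => ∑ d, (g.realMatrix x y)⁻¹ c d *
      g.christoffelLow x y (realBasis d) (realBasis a) (realBasis b)) z :=
    DifferentiableAt.fun_sum fun d _ =>
      (DifferentiableAt.matrix_inv
        (fun i j => (g.hasFDerivAt_metricForm x hz (realBasis i) (realBasis j)).differentiableAt)
        (g.realMatrix_isUnit_det x hz) c d).mul
      (g.hasFDerivAt_christoffelLow x hz _ _ _).differentiableAt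
  refine h.congr_of_eventuallyEq ?_
  filter_upwards [(chartAt C2 x).open_target.mem_nhds hz] with y hy
    using g.christoffel_eq x hy c a b

/-- Lowering the index of the Christoffel symbols. -/
theorem sum_realMatrix_mul_christoffel (g : HermitianMetric M) (x : M) {z : C2}
    (hz : z ∈ (chartAt C2 x).target) (e a b : Fin 4) :
    ∑ c, g.realMatrix x z e c * g.christoffel x c a b z =
      g.christoffelLow x z (realBasis e) (realBasis a) (realBasis b) := by
  have h : (g.realMatrix x z) * (g.realMatrix x z)⁻¹ = 1 :=
    Matrix.mul_nonsing_inv _ (g.realMatrix_isUnit_det x hz)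
  simp only [g.christoffel_eq x hz, Finset.mul_sum, ← mul_assoc]
  rw [Finset.sum_comm]
  simp only [← Finset.sum_mul, ← Matrix.mul_apply, h, Matrix.one_apply]
  simp

/-- Differentiating `g_{ec} Γᶜ_{ab} = Γ_{e,ab}`. -/
theorem sum_realMatrix_mul_pd_christoffel (g : HermitianMetric M) (x : M) {z : C2}
    (hz : z ∈ (chartAt C2 x).target) (e a b d : Fin 4) :
    ∑ c, g.realMatrix x z e c * pd d (g.christoffel x c a b) z =
      (1 / 2 : ℝ) * (g.metricD2 x z (realBasis d) (realBasis a) (realBasis b) (realBasis e) +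
        g.metricD2 x z (realBasis d) (realBasis b) (realBasis a) (realBasis e) -
        g.metricD2 x z (realBasis d) (realBasis e) (realBasis a) (realBasis b)) -
      ∑ c, g.metricD1 x z (realBasis d) (realBasis e) (realBasis c) * g.christoffel x c a b z := by
  have h1 := HasFDerivAt.fun_sum (u := Finset.univ) fun c _ =>
    (g.hasFDerivAt_metricForm x hz (realBasis e) (realBasis c)).mul
    (g.differentiableAt_christoffel x hz c a b).hasFDerivAt
  have h2 : HasFDerivAt (fun y => ∑ c, g.metricForm x y (realBasis e) (realBasis c) *
      g.christoffel x c a b y) _ z :=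
    (g.hasFDerivAt_christoffelLow x hz (realBasis e) (realBasis a)
      (realBasis b)).congr_of_eventuallyEq (by
        filter_upwards [(chartAt C2 x).open_target.mem_nhds hz] with y hy
          using g.sum_realMatrix_mul_christoffel x hy e a b)
  have h3 := congrArg (fun L : C2 →L[ℝ] ℝ => L (realBasis d)) (h1.unique h2)
  simp only [sum_apply, add_apply,
    smul_apply, sub_apply, ContinuousLinearMap.flip_apply,
    smul_eq_mul, Finset.sum_add_distrib] at h3
  rw [eq_sub_iff_add_eq, ← h3]
  congr 1
  refine Finset.sum_congr rfl fun c _ => ?_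
  rw [mul_comm]

/-- The covariant curvature tensor `R(u, v, w, y)`, as a function of vectors of `ℂ²`: with lowered
indices the derivatives of the inverse metric drop out of the curvature. -/
def curvForm (g : HermitianMetric M) (x : M) (u v w y : C2) : ℝ :=
  let z := chartAt C2 x x
  (1 / 2 : ℝ) * (g.metricD2 x z w v u y - g.metricD2 x z w u v y
      - g.metricD2 x z y v u w + g.metricD2 x z y u v w)
    + ∑ e, ∑ f, g.gUp x e f *
      (g.christoffelLow x z (realBasis e) y u * g.christoffelLow x z (realBasis f) w v
        - g.christoffelLow x z (realBasis e) w u * g.christoffelLow x z (realBasis f) y v)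

/-- Compatibility of the Levi-Civita connection with the metric. -/
theorem metricD1_eq_christoffelLow (g : HermitianMetric M) (x : M) {z : C2}
    (hz : z ∈ (chartAt C2 x).target) (w u v : C2) :
    g.metricD1 x z w u v = g.christoffelLow x z u w v + g.christoffelLow x z v w u := by
  simp only [christoffelLow, g.metricD1_symm x hz w v u]
  ring

/-- The curvature, defined by differentiating `Γᶜ_{ab}`, in terms of the derivatives of the metric
alone. The terms `∂g · Γ` from lowering the index inside the derivative combine with the quadratic
terms by metric compatibility, `metricD1_eq_christoffelLow`. -/
theorem riemann_eq_curvForm (g : HermitianMetric M) (x : M) (a b c d : Fin 4) :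
    g.riemann x a b c d =
      g.curvForm x (realBasis a) (realBasis b) (realBasis c) (realBasis d) := by
  have hz : chartAt C2 x x ∈ (chartAt C2 x).target := mem_chart_target C2 x
  have h1 := g.sum_realMatrix_mul_pd_christoffel x hz a d b c
  have h2 := g.sum_realMatrix_mul_pd_christoffel x hz a c b d
  have h3 : ∀ p q f, ∑ e, g.gDown x a e * (g.christoffel x e p f (chartAt C2 x x)) * q =
      g.christoffelLow x (chartAt C2 x x) (realBasis a) (realBasis p) (realBasis f) * q := by
    intro p q f
    rw [← g.sum_realMatrix_mul_christoffel x hz, Finset.sum_mul]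
    rfl
  simp only [riemann, riemannUp, mul_add, mul_sub, Finset.sum_add_distrib, Finset.sum_sub_distrib,
    Finset.mul_sum]
  rw [Finset.sum_comm (s := Finset.univ) (t := Finset.univ) (f := fun e f => g.gDown x a e *
    (g.christoffel x e c f (chartAt C2 x x) * g.christoffel x f d b (chartAt C2 x x))),
    Finset.sum_comm (s := Finset.univ) (t := Finset.univ) (f := fun e f => g.gDown x a e *
    (g.christoffel x e d f (chartAt C2 x x) * g.christoffel x f c b (chartAt C2 x x)))]
  simp only [← mul_assoc, h3]
  rw [show ∑ e, g.gDown x a e * pd c (g.christoffel x e d b) (chartAt C2 x x) = _ from h1,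
    show ∑ e, g.gDown x a e * pd d (g.christoffel x e c b) (chartAt C2 x x) = _ from h2]
  simp only [g.metricD1_eq_christoffelLow x hz, add_mul, Finset.sum_add_distrib]
  have h4 : ∀ p q, ∑ e,
      g.christoffelLow x (chartAt C2 x x) (realBasis e) (realBasis p) (realBasis a) *
      g.christoffel x e q b (chartAt C2 x x) = ∑ e, ∑ f, g.gUp x e f *
      (g.christoffelLow x (chartAt C2 x x) (realBasis e) (realBasis p) (realBasis a) *
        g.christoffelLow x (chartAt C2 x x) (realBasis f) (realBasis q) (realBasis b)) := by
    intro p q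
    refine Finset.sum_congr rfl fun e _ => ?_
    rw [g.christoffel_eq x hz, Finset.mul_sum]
    refine Finset.sum_congr rfl fun f _ => ?_
    rw [gUp]
    ring
  simp only [curvForm, mul_sub, Finset.sum_sub_distrib]
  simp only [← mul_sub, h4]
  rw [g.metricD2_comm x hz (realBasis c) (realBasis d),
    g.metricD2_symm x hz (realBasis c) (realBasis b),
    g.metricD2_symm x hz (realBasis d) (realBasis b),
    g.metricD2_symm x hz (realBasis c) (realBasis a) (realBasis d),
    g.metricD2_symm x hz (realBasis d) (realBasis a) (realBasis c)]
  ring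

/-! ### Unitary frames -/

/-- The real coordinates `x₁, y₁, x₂, y₂` of a vector of `ℂ²`. -/
def realCoord (v : C2) : Fin 4 → ℝ := ![(v 0).re, (v 0).im, (v 1).re, (v 1).im]

theorem sum_realCoord_smul (v : C2) : ∑ a, realCoord v a • realBasis a = v := by
  ext i
  fin_cases i <;>
    simp [Fin.sum_univ_four, realBasis, ex, ey, realCoord]

theorem map_eq_sum_realCoord (L : C2 →L[ℝ] ℝ) (v : C2) :
    L v = ∑ a, realCoord v a * L (realBasis a) := by
  conv_lhs => rw [← sum_realCoord_smul v]
  simp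

/-- The real frame `u, Ju, v, Jv` of `ℂ²`. -/
def frame (u v : C2) : Fin 4 → C2 := ![u, Complex.I • u, v, Complex.I • v]

/-- The matrix whose columns are the real coordinates of the frame `u, Ju, v, Jv`. -/
def frameMatrix (u v : C2) : Matrix (Fin 4) (Fin 4) ℝ :=
  Matrix.of fun a i => realCoord (frame u v i) a

/-- `u`, `v` is a unitary frame at `x` up to the scale `r`: the real frame `u, Ju, v, Jv` is
orthogonal for the metric at `x`, and its members have squared length `r`. -/
structure IsUnitaryFrame (g : HermitianMetric M) (x : M) (u v : C2) (r : ℝ) : Prop where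
  pos : 0 < r
  left : g.metricForm x (chartAt C2 x x) u u = r
  right : g.metricForm x (chartAt C2 x x) v v = r
  ortho : g.metricForm x (chartAt C2 x x) u v = 0
  ortho_I : g.metricForm x (chartAt C2 x x) u (Complex.I • v) = 0

theorem I_smul_I_smul (v : C2) : Complex.I • Complex.I • v = -v := by
  rw [smul_smul, Complex.I_mul_I, neg_one_smul]

theorem metricForm_smul_I_left (g : HermitianMetric M) (x : M) {z : C2}
    (hz : z ∈ (chartAt C2 x).target) (u v : C2) :
    g.metricForm x z (Complex.I • u) v = - g.metricForm x z u (Complex.I • v) := by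
  rw [← g.metricForm_smul_I x hz u, I_smul_I_smul, map_neg, neg_neg]

theorem metricForm_self_smul_I (g : HermitianMetric M) (x : M) {z : C2}
    (hz : z ∈ (chartAt C2 x).target) (u : C2) :
    g.metricForm x z u (Complex.I • u) = 0 := by
  have := g.metricForm_smul_I_left x hz u u
  rw [metricForm_symm] at this
  linarith

/-- The Gram matrix of the real frame `u, Ju, v, Jv`. -/
theorem IsUnitaryFrame.metricForm_frame {g : HermitianMetric M} {x : M} {u v : C2} {r : ℝ}
    (h : g.IsUnitaryFrame x u v r) (i j : Fin 4) :
    g.metricForm x (chartAt C2 x x) (frame u v i) (frame u v j) = if i = j then r else 0 := by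
  have hz := mem_chart_target C2 x
  have h1 := h.ortho
  have h2 := h.ortho_I
  have h3 : g.metricForm x (chartAt C2 x x) v u = 0 := by rw [metricForm_symm, h1]
  have h4 : g.metricForm x (chartAt C2 x x) v (Complex.I • u) = 0 := by
    rw [metricForm_symm, g.metricForm_smul_I_left x hz, h2, neg_zero]
  fin_cases i <;> fin_cases j <;>
    simp [frame, g.metricForm_smul_I x hz, g.metricForm_smul_I_left x hz,
      g.metricForm_self_smul_I x hz, h.left, h.right, h1, h2, h3, h4]

theorem IsUnitaryFrame.transpose_mul_mul {g : HermitianMetric M} {x : M} {u v : C2} {r : ℝ}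
    (h : g.IsUnitaryFrame x u v r) :
    (frameMatrix u v).transpose * (g.realMatrix x (chartAt C2 x x) * frameMatrix u v) =
      r • (1 : Matrix (Fin 4) (Fin 4) ℝ) := by
  ext i j
  have h1 := h.metricForm_frame i j
  rw [map_eq_sum_realCoord] at h1
  simp only [g.metricForm_symm x _ (frame u v i)] at h1
  simp only [map_eq_sum_realCoord _ (frame u v i)] at h1
  simp only [Matrix.mul_apply, Matrix.transpose_apply, Matrix.smul_apply, Matrix.one_apply,
    frameMatrix, Matrix.of_apply, smul_eq_mul, mul_ite, mul_one, mul_zero, ← h1, Finset.mul_sum]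
  rw [Finset.sum_comm]
  refine Finset.sum_congr rfl fun b _ => Finset.sum_congr rfl fun a _ => ?_
  rw [g.metricForm_symm, realMatrix, Matrix.of_apply, metricForm_apply]
  ring

theorem IsUnitaryFrame.inv_realMatrix {g : HermitianMetric M} {x : M} {u v : C2} {r : ℝ}
    (h : g.IsUnitaryFrame x u v r) :
    (g.realMatrix x (chartAt C2 x x))⁻¹ =
      r⁻¹ • (frameMatrix u v * (frameMatrix u v).transpose) := by
  apply Matrix.inv_eq_right_inv
  have h1 : (r⁻¹ • (frameMatrix u v).transpose) *
      (g.realMatrix x (chartAt C2 x x) * frameMatrix u v) = 1 := by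
    rw [Matrix.smul_mul, h.transpose_mul_mul, smul_smul, inv_mul_cancel₀ h.pos.ne', one_smul]
  rw [mul_eq_one_comm, Matrix.mul_smul] at h1
  rw [Matrix.mul_smul, ← Matrix.mul_assoc, h1]

/-- Tracing with the inverse metric is summing over a unitary frame. -/
theorem IsUnitaryFrame.sum_gUp_mul {g : HermitianMetric M} {x : M} {u v : C2} {r : ℝ}
    (h : g.IsUnitaryFrame x u v r) (B : C2 →L[ℝ] C2 →L[ℝ] ℝ) :
    ∑ e, ∑ f, g.gUp x e f * B (realBasis e) (realBasis f) =
      r⁻¹ * ∑ i, B (frame u v i) (frame u v i) := by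
  have h1 : ∀ w, B w w =
      ∑ e, ∑ f, realCoord w e * realCoord w f * B (realBasis e) (realBasis f) := by
    intro w
    conv_lhs => rw [← sum_realCoord_smul w]
    simp only [map_sum, map_smul, sum_apply, smul_apply, smul_eq_mul, Finset.mul_sum]
    rw [Finset.sum_comm]
    refine Finset.sum_congr rfl fun b _ => Finset.sum_congr rfl fun a _ => ?_
    ring
  simp only [h1, gUp, h.inv_realMatrix, Matrix.smul_apply, Matrix.mul_apply, Matrix.transpose_apply,
    frameMatrix, Matrix.of_apply, smul_eq_mul, Finset.sum_mul, Finset.mul_sum]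
  symm
  rw [Finset.sum_comm]
  refine Finset.sum_congr rfl fun e _ => ?_
  rw [Finset.sum_comm]
  refine Finset.sum_congr rfl fun f _ => Finset.sum_congr rfl fun i _ => ?_
  ring

/-- The Christoffel symbols `Γ(w; u, v)` of the first kind, as a linear form in `w`. -/
def christoffelForm (g : HermitianMetric M) (x : M) (z u v : C2) : C2 →L[ℝ] ℝ :=
  (1 / 2 : ℝ) • (g.metricD1 x z u v + g.metricD1 x z v u - ((g.metricD1 x z).flip u).flip v)

theorem christoffelForm_apply (g : HermitianMetric M) (x : M) (z u v w : C2) :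
    g.christoffelForm x z u v w = g.christoffelLow x z w u v := rfl

/-- The product of two linear forms, as a bilinear form. -/
def prodForm (L L' : C2 →L[ℝ] ℝ) : C2 →L[ℝ] C2 →L[ℝ] ℝ := L.smulRight L'

theorem prodForm_apply (L L' : C2 →L[ℝ] ℝ) (v w : C2) : prodForm L L' v w = L v * L' w := rfl

/-- The curvature with the inverse metric replaced by a sum over the frame. From here on, algebraic
identities of the curvature are checked by expanding this sum. -/
theorem IsUnitaryFrame.curvForm_eq {g : HermitianMetric M} {x : M} {u v : C2} {r : ℝ}
    (h : g.IsUnitaryFrame x u v r) (a b c d : C2) :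
    g.curvForm x a b c d =
      (1 / 2 : ℝ) * (g.metricD2 x (chartAt C2 x x) c b a d - g.metricD2 x (chartAt C2 x x) c a b d
        - g.metricD2 x (chartAt C2 x x) d b a c + g.metricD2 x (chartAt C2 x x) d a b c)
      + r⁻¹ * ∑ i, (g.christoffelLow x (chartAt C2 x x) (frame u v i) d a *
          g.christoffelLow x (chartAt C2 x x) (frame u v i) c b
        - g.christoffelLow x (chartAt C2 x x) (frame u v i) c a *
          g.christoffelLow x (chartAt C2 x x) (frame u v i) d b) := by
  have h1 := h.sum_gUp_mul (prodForm (g.christoffelForm x (chartAt C2 x x) d a)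
    (g.christoffelForm x (chartAt C2 x x) c b) - prodForm (g.christoffelForm x (chartAt C2 x x) c a)
    (g.christoffelForm x (chartAt C2 x x) d b))
  simp only [sub_apply, prodForm_apply, christoffelForm_apply] at h1
  rw [← h1]
  rfl

/-! ### Symmetries of the Riemannian curvature -/

theorem christoffelLow_symm (g : HermitianMetric M) (x : M) {z : C2}
    (hz : z ∈ (chartAt C2 x).target) (w u v : C2) :
    g.christoffelLow x z w u v = g.christoffelLow x z w v u := by
  simp only [christoffelLow, g.metricD1_symm x hz w u v]
  ring

theorem IsUnitaryFrame.curvForm_swap_left {g : HermitianMetric M} {x : M} {u v : C2} {r : ℝ}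
    (h : g.IsUnitaryFrame x u v r) (a b c d : C2) :
    g.curvForm x b a c d = - g.curvForm x a b c d := by
  simp only [h.curvForm_eq, Fin.sum_univ_four]
  ring

theorem IsUnitaryFrame.curvForm_swap_right {g : HermitianMetric M} {x : M} {u v : C2} {r : ℝ}
    (h : g.IsUnitaryFrame x u v r) (a b c d : C2) :
    g.curvForm x a b d c = - g.curvForm x a b c d := by
  simp only [h.curvForm_eq, Fin.sum_univ_four]
  ring

theorem IsUnitaryFrame.curvForm_pair_symm {g : HermitianMetric M} {x : M} {u v : C2} {r : ℝ}
    (h : g.IsUnitaryFrame x u v r) (a b c d : C2) :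
    g.curvForm x c d a b = g.curvForm x a b c d := by
  have hz := mem_chart_target C2 x
  simp only [h.curvForm_eq, Fin.sum_univ_four, g.christoffelLow_symm x hz _ b c,
    g.christoffelLow_symm x hz _ a d, g.christoffelLow_symm x hz _ a c,
    g.christoffelLow_symm x hz _ b d,
    g.metricD2_comm x hz a d, g.metricD2_comm x hz a c, g.metricD2_comm x hz b d,
    g.metricD2_comm x hz b c, g.metricD2_symm x hz _ _ c b, g.metricD2_symm x hz _ _ d b,
    g.metricD2_symm x hz _ _ c a, g.metricD2_symm x hz _ _ d a]
  ring

/-- The first Bianchi identity. -/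
theorem IsUnitaryFrame.curvForm_bianchi {g : HermitianMetric M} {x : M} {u v : C2} {r : ℝ}
    (h : g.IsUnitaryFrame x u v r) (a b c d : C2) :
    g.curvForm x a b c d + g.curvForm x a c d b + g.curvForm x a d b c = 0 := by
  have hz := mem_chart_target C2 x
  simp only [h.curvForm_eq, Fin.sum_univ_four, g.christoffelLow_symm x hz _ d c,
    g.christoffelLow_symm x hz _ c b, g.christoffelLow_symm x hz _ d b,
    g.metricD2_comm x hz d b, g.metricD2_comm x hz d c,
    g.metricD2_comm x hz c b, g.metricD2_symm x hz _ _ d c, g.metricD2_symm x hz _ _ c b,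
    g.metricD2_symm x hz _ _ d b]
  ring

theorem IsUnitaryFrame.curvForm_add {g : HermitianMetric M} {x : M} {u v : C2} {r : ℝ}
    (h : g.IsUnitaryFrame x u v r) (a a' b c d : C2) :
    g.curvForm x (a + a') b c d = g.curvForm x a b c d + g.curvForm x a' b c d := by
  simp only [h.curvForm_eq, Fin.sum_univ_four, christoffelLow, map_add, add_apply]
  ring

theorem IsUnitaryFrame.curvForm_smul {g : HermitianMetric M} {x : M} {u v : C2} {r : ℝ}
    (h : g.IsUnitaryFrame x u v r) (t : ℝ) (a b c d : C2) :
    g.curvForm x (t • a) b c d = t * g.curvForm x a b c d := by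
  simp only [h.curvForm_eq, Fin.sum_univ_four, christoffelLow, map_smul, smul_apply, smul_eq_mul]
  ring

/-! ### Contraction of Wirtinger derivatives -/

/-- The derivative `∂_X = (D_X - i D_{JX}) / 2` along the `(1, 0)`-vector of `X`, where `D` is the
real linear map `L`. -/
def wirt (L : C2 →L[ℝ] ℂ) (X : C2) : ℂ := (1 / 2 : ℂ) * (L X - Complex.I * L (Complex.I • X))

/-- The conjugate derivative `∂_X̄ = (D_X + i D_{JX}) / 2`, where `D` is the real linear map `L`. -/
def wirtBar (L : C2 →L[ℝ] ℂ) (X : C2) : ℂ := (1 / 2 : ℂ) * (L X + Complex.I * L (Complex.I • X))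

theorem map_eq_sum_re_im (L : C2 →L[ℝ] ℂ) (X : C2) :
    L X = ∑ i, ((X i).re * L (ex i) + (X i).im * L (ey i)) := by
  conv_lhs => rw [← sum_realCoord_smul X]
  simp [Fin.sum_univ_four, Fin.sum_univ_two, realCoord, realBasis, add_assoc]

theorem I_smul_ex (i : Fin 2) : Complex.I • ex i = ey i := by
  ext j; simp [ex, ey]

/-- Complex linearity of `∂_X` in `X`, which turns contractions of coordinate derivatives `∂/∂zᵢ`
into derivatives along vectors. -/
theorem sum_mul_wirt (L : C2 →L[ℝ] ℂ) (X : C2) : ∑ i, X i * wirt L (ex i) = wirt L X := by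
  simp only [wirt, map_eq_sum_re_im L X, map_eq_sum_re_im L (Complex.I • X), I_smul_ex,
    Fin.sum_univ_two,
    PiLp.smul_apply, smul_eq_mul, Complex.mul_re, Complex.mul_im, Complex.I_re, Complex.I_im]
  conv_lhs => rw [← Complex.re_add_im (X 0), ← Complex.re_add_im (X 1)]
  push_cast
  linear_combination (-1/2 : ℂ) * (L (ey 0) * (X 0).im + L (ey 1) * (X 1).im) * Complex.I_mul_I

/-- Conjugate linearity of the derivative along `X̄` in `X`. -/
theorem sum_star_mul_wirtBar (L : C2 →L[ℝ] ℂ) (X : C2) :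
    ∑ i, star (X i) * wirtBar L (ex i) = wirtBar L X := by
  simp only [wirtBar, map_eq_sum_re_im L X, map_eq_sum_re_im L (Complex.I • X), I_smul_ex,
    Fin.sum_univ_two,
    PiLp.smul_apply, smul_eq_mul, Complex.mul_re, Complex.mul_im, Complex.I_re, Complex.I_im]
  conv_lhs => rw [← Complex.re_add_im (X 0), ← Complex.re_add_im (X 1)]
  simp only [star_add, star_mul', Complex.star_def, Complex.conj_ofReal, Complex.conj_I]
  push_cast
  linear_combination (-1/2 : ℂ) * (L (ey 0) * (X 0).im + L (ey 1) * (X 1).im) * Complex.I_mul_I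

/-- The value `B(X, Ȳ)` of the complex bilinear extension of `B` on the `(1, 0)`-vector of `X` and
the `(0, 1)`-vector of `Y`. -/
def hermForm (B : C2 →L[ℝ] C2 →L[ℝ] ℝ) (X Y : C2) : ℂ :=
  (1 / 4 : ℂ) * ((B X Y : ℂ) + Complex.I * (B X (Complex.I • Y) : ℂ)
    - Complex.I * (B (Complex.I • X) Y : ℂ) + (B (Complex.I • X) (Complex.I • Y) : ℂ))

/-- `B(X, Ȳ)` as a real linear function of `B`. -/
def hermFormL (X Y : C2) : (C2 →L[ℝ] C2 →L[ℝ] ℝ) →L[ℝ] ℂ :=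
  let e (u v : C2) : (C2 →L[ℝ] C2 →L[ℝ] ℝ) →L[ℝ] ℂ :=
    Complex.ofRealCLM.comp ((ContinuousLinearMap.apply ℝ ℝ v).comp
      (ContinuousLinearMap.apply ℝ (C2 →L[ℝ] ℝ) u))
  (1 / 4 : ℂ) • (e X Y + Complex.I • e X (Complex.I • Y) - Complex.I • e (Complex.I • X) Y
    + e (Complex.I • X) (Complex.I • Y))

theorem hermFormL_apply (B : C2 →L[ℝ] C2 →L[ℝ] ℝ) (X Y : C2) :
    hermFormL X Y B = hermForm B X Y := by
  simp [hermFormL, hermForm]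
  ring

theorem sum_mul_hermForm (B : C2 →L[ℝ] C2 →L[ℝ] ℝ) (X Y : C2) :
    ∑ i, X i * hermForm B (ex i) Y = hermForm B X Y := by
  have h := sum_mul_wirt ((1 / 2 : ℂ) • (Complex.ofRealCLM.comp (B.flip Y) +
    Complex.I • Complex.ofRealCLM.comp (B.flip (Complex.I • Y)))) X
  convert h using 1
  · refine Finset.sum_congr rfl fun i _ => ?_
    refine congrArg _ ?_
    simp [hermForm, wirt]
    linear_combination (1/4 : ℂ) * B (Complex.I • ex i) (Complex.I • Y) * Complex.I_mul_I
  · simp [hermForm, wirt]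
    linear_combination (1/4 : ℂ) * B (Complex.I • X) (Complex.I • Y) * Complex.I_mul_I

theorem sum_star_mul_hermForm (B : C2 →L[ℝ] C2 →L[ℝ] ℝ) (X Y : C2) :
    ∑ i, star (Y i) * hermForm B X (ex i) = hermForm B X Y := by
  have h := sum_star_mul_wirtBar ((1 / 2 : ℂ) • (Complex.ofRealCLM.comp (B X) -
    Complex.I • Complex.ofRealCLM.comp (B (Complex.I • X)))) Y
  convert h using 1
  · refine Finset.sum_congr rfl fun i _ => ?_
    refine congrArg _ ?_
    simp [hermForm, wirtBar]
    linear_combination (1/4 : ℂ) * B (Complex.I • X) (Complex.I • ex i) * Complex.I_mul_I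
  · simp [hermForm, wirtBar]
    linear_combination (1/4 : ℂ) * B (Complex.I • X) (Complex.I • Y) * Complex.I_mul_I

theorem hermMatrix_apply (g : HermitianMetric M) (x : M) (z : C2) (i j : Fin 2) :
    g.hermMatrix x z i j = hermForm (g.metricForm x z) (ex i) (ex j) := by
  simp only [hermMatrix, Matrix.of_apply, hermForm, I_smul_ex, metricForm_apply]

theorem hasFDerivAt_hermMatrix (g : HermitianMetric M) (x : M) {z : C2}
    (hz : z ∈ (chartAt C2 x).target) (k l : Fin 2) :
    HasFDerivAt (fun y => g.hermMatrix x y k l)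
      ((hermFormL (ex k) (ex l)).comp (g.metricD1 x z)) z := by
  have h := (hermFormL (ex k) (ex l)).hasFDerivAt.comp z
    (g.differentiableAt_metricForm x hz).hasFDerivAt
  refine h.congr_of_eventuallyEq (Filter.Eventually.of_forall fun y => ?_)
  simp only [hermMatrix_apply, Function.comp, hermFormL_apply]

theorem dz_hermMatrix (g : HermitianMetric M) (x : M) {z : C2}
    (hz : z ∈ (chartAt C2 x).target) (i k l : Fin 2) :
    dz i (fun y => g.hermMatrix x y k l) z =
      wirt ((hermFormL (ex k) (ex l)).comp (g.metricD1 x z)) (ex i) := by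
  rw [dz, (g.hasFDerivAt_hermMatrix x hz k l).fderiv, wirt, I_smul_ex]

theorem dzbar_hermMatrix (g : HermitianMetric M) (x : M) {z : C2}
    (hz : z ∈ (chartAt C2 x).target) (j k l : Fin 2) :
    dzbar j (fun y => g.hermMatrix x y k l) z =
      wirtBar ((hermFormL (ex k) (ex l)).comp (g.metricD1 x z)) (ex j) := by
  rw [dzbar, (g.hasFDerivAt_hermMatrix x hz k l).fderiv, wirtBar, I_smul_ex]

/-- The second derivatives `∂_b ∂_w g(X, Ȳ)` in the real direction `b` and `w` in the conjugate of
`Z`. -/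
def hermD2Bar (g : HermitianMetric M) (x : M) (z Z X Y : C2) : C2 →L[ℝ] ℂ :=
  (1 / 2 : ℂ) • ((hermFormL X Y).comp ((g.metricD2 x z).flip Z) +
    Complex.I • (hermFormL X Y).comp ((g.metricD2 x z).flip (Complex.I • Z)))

theorem dz_dzbar_hermMatrix (g : HermitianMetric M) (x : M) {z : C2}
    (hz : z ∈ (chartAt C2 x).target) (i j k l : Fin 2) :
    dz i (fun y => dzbar j (fun y' => g.hermMatrix x y' k l) y) z =
      wirt (g.hermD2Bar x z (ex j) (ex k) (ex l)) (ex i) := by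
  have h0 := (g.differentiableAt_metricD1 x hz).hasFDerivAt
  have h1 : ∀ w : C2, HasFDerivAt (fun y => hermFormL (ex k) (ex l) (g.metricD1 x y w))
      ((hermFormL (ex k) (ex l)).comp ((g.metricD2 x z).flip w)) z := by
    intro w
    have h2 := h0.clm_apply (hasFDerivAt_const w z)
    refine ((hermFormL (ex k) (ex l)).hasFDerivAt.comp z h2).congr_fderiv ?_
    ext v
    simp [metricD2]
  have h3 : HasFDerivAt (fun y => dzbar j (fun y' => g.hermMatrix x y' k l) y)
      (g.hermD2Bar x z (ex j) (ex k) (ex l)) z := by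
    refine (((h1 (ex j)).add ((h1 (Complex.I • ex j)).const_smul Complex.I)).const_smul
      (1 / 2 : ℂ)).congr_of_eventuallyEq ?_
    filter_upwards [(chartAt C2 x).open_target.mem_nhds hz] with y hy
    rw [g.dzbar_hermMatrix x hy]
    rfl
  rw [dz, h3.fderiv, wirt, I_smul_ex]

/-- The second derivatives `∂_Z ∂_w g(X, Ȳ)`, with `w` in a real direction. -/
def hermD2 (g : HermitianMetric M) (x : M) (z Z X Y : C2) : C2 →L[ℝ] ℂ :=
  (1 / 2 : ℂ) • ((hermFormL X Y).comp (g.metricD2 x z Z) -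
    Complex.I • (hermFormL X Y).comp (g.metricD2 x z (Complex.I • Z)))

/-- Both sides are the mixed derivative `∂_Z ∂_W̄ g(X, Ȳ)`, seen as a function of the one or of the
other direction. -/
theorem wirt_hermD2Bar (g : HermitianMetric M) (x : M) (z Z W X Y : C2) :
    wirt (g.hermD2Bar x z W X Y) Z = wirtBar (g.hermD2 x z Z X Y) W := by
  simp [wirt, wirtBar, hermD2, hermD2Bar]
  ring

theorem sum_sum_hermForm (B : C2 →L[ℝ] C2 →L[ℝ] ℝ) (X Y : C2) :
    ∑ k, ∑ l, X k * (star (Y l) * hermForm B (ex k) (ex l)) = hermForm B X Y := by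
  simp only [← Finset.mul_sum, sum_star_mul_hermForm, sum_mul_hermForm]

theorem sum_sum_wirt_hermD2Bar (g : HermitianMetric M) (x : M) (z Z W X Y : C2) :
    ∑ k, X k * ∑ l, star (Y l) * wirt (g.hermD2Bar x z W (ex k) (ex l)) Z =
      wirt (g.hermD2Bar x z W X Y) Z := by
  simp only [wirt, hermD2Bar, smul_apply, add_apply, ContinuousLinearMap.comp_apply,
    hermFormL_apply, ContinuousLinearMap.flip_apply, smul_eq_mul]
  simp only [← sum_sum_hermForm _ X Y, Fin.sum_univ_two]
  ring

/-- The first derivatives `∂_w g(X, Ȳ)`, with `w` in a real direction. -/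
def hermD1 (g : HermitianMetric M) (x : M) (z X Y : C2) : C2 →L[ℝ] ℂ :=
  (hermFormL X Y).comp (g.metricD1 x z)

theorem sum_mul_wirt_hermD1 (g : HermitianMetric M) (x : M) (z Z X Y : C2) :
    ∑ k, X k * wirt (g.hermD1 x z (ex k) Y) Z = wirt (g.hermD1 x z X Y) Z := by
  simp only [wirt, hermD1, ContinuousLinearMap.comp_apply, hermFormL_apply]
  simp only [← sum_mul_hermForm _ X, Fin.sum_univ_two]
  ring

theorem sum_mul_wirtBar_hermD1 (g : HermitianMetric M) (x : M) (z Z X Y : C2) :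
    ∑ k, X k * wirtBar (g.hermD1 x z (ex k) Y) Z = wirtBar (g.hermD1 x z X Y) Z := by
  simp only [wirtBar, hermD1, ContinuousLinearMap.comp_apply, hermFormL_apply]
  simp only [← sum_mul_hermForm _ X, Fin.sum_univ_two]
  ring

theorem sum_star_mul_wirt_hermD1 (g : HermitianMetric M) (x : M) (z Z X Y : C2) :
    ∑ l, star (Y l) * wirt (g.hermD1 x z X (ex l)) Z = wirt (g.hermD1 x z X Y) Z := by
  simp only [wirt, hermD1, ContinuousLinearMap.comp_apply, hermFormL_apply]
  simp only [← sum_star_mul_hermForm _ X Y, Fin.sum_univ_two]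
  ring

theorem sum_star_mul_wirtBar_hermD1 (g : HermitianMetric M) (x : M) (z Z X Y : C2) :
    ∑ l, star (Y l) * wirtBar (g.hermD1 x z X (ex l)) Z = wirtBar (g.hermD1 x z X Y) Z := by
  simp only [wirtBar, hermD1, ContinuousLinearMap.comp_apply, hermFormL_apply]
  simp only [← sum_star_mul_hermForm _ X Y, Fin.sum_univ_two]
  ring

/-- The Chern curvature `R(X, Ȳ, X, Ȳ)`, for the `(1, 0)`-vectors with components `Xⁱ`, `Yⁱ`. -/
def chernForm (g : HermitianMetric M) (x : M) (X Y : C2) : ℂ :=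
  ∑ i, ∑ j, ∑ k, ∑ l, g.chernCurv x i j k l * X i * star (Y j) * X k * star (Y l)

/-- The contraction of the coordinate formula for the Chern curvature, with only the inverse metric
left in coordinates. -/
theorem chernForm_eq_sum_hermInv (g : HermitianMetric M) (x : M) (X Y : C2) :
    g.chernForm x X Y =
      - wirt (g.hermD2Bar x (chartAt C2 x x) Y X Y) X +
      ∑ p, ∑ q, g.hermInv x p q * wirt (g.hermD1 x (chartAt C2 x x) X (ex q)) X *
        wirtBar (g.hermD1 x (chartAt C2 x x) (ex p) Y) Y := by
  have hz := mem_chart_target C2 x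
  have h1 : wirt (g.hermD2Bar x (chartAt C2 x x) Y X Y) X = ∑ i, ∑ j, ∑ k, ∑ l,
      X i * (star (Y j) * (X k * (star (Y l) *
        wirt (g.hermD2Bar x (chartAt C2 x x) (ex j) (ex k) (ex l)) (ex i)))) := by
    simp only [← Finset.mul_sum, sum_sum_wirt_hermD2Bar]
    simp only [wirt_hermD2Bar, sum_star_mul_wirtBar]
    simp only [← wirt_hermD2Bar, sum_mul_wirt]
  have h2 : ∀ q, wirt (g.hermD1 x (chartAt C2 x x) X (ex q)) X = ∑ i, ∑ k,
      X i * (X k * wirt (g.hermD1 x (chartAt C2 x x) (ex k) (ex q)) (ex i)) := by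
    intro q
    simp only [← Finset.mul_sum, sum_mul_wirt_hermD1, sum_mul_wirt]
  have h3 : ∀ p, wirtBar (g.hermD1 x (chartAt C2 x x) (ex p) Y) Y = ∑ j, ∑ l,
      star (Y j) * (star (Y l) * wirtBar (g.hermD1 x (chartAt C2 x x) (ex p) (ex l)) (ex j)) := by
    intro p
    simp only [← Finset.mul_sum, sum_star_mul_wirtBar_hermD1, sum_star_mul_wirtBar]
  have h4 : ∀ i j k l, g.chernCurv x i j k l =
      - wirt (g.hermD2Bar x (chartAt C2 x x) (ex j) (ex k) (ex l)) (ex i) +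
      ∑ p, ∑ q, g.hermInv x p q * wirt (g.hermD1 x (chartAt C2 x x) (ex k) (ex q)) (ex i) *
        wirtBar (g.hermD1 x (chartAt C2 x x) (ex p) (ex l)) (ex j) := by
    intro i j k l
    simp only [chernCurv, g.dz_dzbar_hermMatrix x hz, g.dz_hermMatrix x hz,
      g.dzbar_hermMatrix x hz, hermD1]
  simp only [chernForm, h1, h2, h3, h4, Fin.sum_univ_two]
  ring

/-- The Hermitian Gram matrix: the `(1, 0)`-vectors of `u`, `v` are orthogonal, of square length `r
/ 2`. -/
theorem IsUnitaryFrame.hermForm_frame {g : HermitianMetric M} {x : M} {u v : C2} {r : ℝ}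
    (h : g.IsUnitaryFrame x u v r) (i j : Fin 2) :
    hermForm (g.metricForm x (chartAt C2 x x)) (![u, v] i) (![u, v] j) =
      if i = j then (r / 2 : ℂ) else 0 := by
  have hf := h.metricForm_frame
  have h1 : ∀ i j : Fin 2, hermForm (g.metricForm x (chartAt C2 x x)) (![u, v] i) (![u, v] j) =
      (1 / 4 : ℂ) * ((g.metricForm x (chartAt C2 x x) (frame u v (![0, 2] i))
        (frame u v (![0, 2] j)) : ℂ)
      + Complex.I * (g.metricForm x (chartAt C2 x x) (frame u v (![0, 2] i))
        (frame u v (![1, 3] j)) : ℂ)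
      - Complex.I * (g.metricForm x (chartAt C2 x x) (frame u v (![1, 3] i))
        (frame u v (![0, 2] j)) : ℂ)
      + (g.metricForm x (chartAt C2 x x) (frame u v (![1, 3] i)) (frame u v (![1, 3] j)) : ℂ)) := by
    intro i j
    fin_cases i <;> fin_cases j <;> rfl
  rw [h1]
  simp only [hf]
  fin_cases i <;> fin_cases j <;> simp <;> ring

/-- The inverse Hermitian metric as a sum over a unitary frame. -/
theorem IsUnitaryFrame.hermInv_eq {g : HermitianMetric M} {x : M} {u v : C2} {r : ℝ}
    (h : g.IsUnitaryFrame x u v r) (p q : Fin 2) :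
    g.hermInv x p q = (2 / r : ℂ) * (star (u q) * u p + star (v q) * v p) := by
  let U : Matrix (Fin 2) (Fin 2) ℂ := Matrix.of fun i p => (![u, v] i) p
  have hr : (r : ℂ) ≠ 0 := by exact_mod_cast h.pos.ne'
  have h1 : U * (g.hermMatrix x (chartAt C2 x x) * U.conjTranspose) =
      (r / 2 : ℂ) • (1 : Matrix (Fin 2) (Fin 2) ℂ) := by
    ext i j
    rw [Matrix.smul_apply, Matrix.one_apply, smul_eq_mul, mul_ite, mul_one, mul_zero,
      ← h.hermForm_frame i j, ← sum_sum_hermForm]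
    simp only [Matrix.mul_apply, Matrix.conjTranspose_apply, hermMatrix_apply, Finset.mul_sum, U,
      Matrix.of_apply]
    refine Finset.sum_congr rfl fun k _ => Finset.sum_congr rfl fun l _ => ?_
    ring
  have h2 : (g.hermMatrix x (chartAt C2 x x))⁻¹ = (2 / r : ℂ) • (U.conjTranspose * U) := by
    apply Matrix.inv_eq_right_inv
    have h3 : ((2 / r : ℂ) • U) * (g.hermMatrix x (chartAt C2 x x) * U.conjTranspose) = 1 := by
      rw [Matrix.smul_mul, h1, smul_smul, div_mul_div_cancel₀ hr, div_self two_ne_zero, one_smul]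
    rw [mul_eq_one_comm, Matrix.mul_smul] at h3
    rw [Matrix.mul_smul, ← Matrix.mul_assoc, h3]
  rw [hermInv, h2]
  simp [Matrix.mul_apply, U, Fin.sum_univ_two]

/-- The Chern curvature `R(X, Ȳ, X, Ȳ)` in a unitary frame. -/
theorem IsUnitaryFrame.chernForm_eq {g : HermitianMetric M} {x : M} {u v : C2} {r : ℝ}
    (h : g.IsUnitaryFrame x u v r) :
    g.chernForm x u v =
      - wirt (g.hermD2Bar x (chartAt C2 x x) v u v) u +
      (2 / r : ℂ) * (wirt (g.hermD1 x (chartAt C2 x x) u u) u *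
          wirtBar (g.hermD1 x (chartAt C2 x x) u v) v +
        wirt (g.hermD1 x (chartAt C2 x x) u v) u *
          wirtBar (g.hermD1 x (chartAt C2 x x) v v) v) := by
  rw [chernForm_eq_sum_hermInv]
  have h1 : ∀ w, wirt (g.hermD1 x (chartAt C2 x x) u w) u = _ := fun w =>
    (g.sum_star_mul_wirt_hermD1 x (chartAt C2 x x) u u w).symm
  have h2 : ∀ w, wirtBar (g.hermD1 x (chartAt C2 x x) w v) v = _ := fun w =>
    (g.sum_mul_wirtBar_hermD1 x (chartAt C2 x x) v w v).symm
  rw [h1 u, h1 v, h2 u, h2 v]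
  simp only [h.hermInv_eq, Fin.sum_univ_two]
  ring

/-! ### Polarization -/

/-- The value of the 4-tensor `S` on `x, x', y, y'`, complex linear in each. For a curvature
tensor, the second and the fourth argument are to be complex conjugates. -/
def quad (S : Fin 2 → Fin 2 → Fin 2 → Fin 2 → ℂ) (x x' y y' : Fin 2 → ℂ) : ℂ :=
  ∑ i, ∑ j, ∑ k, ∑ l, S i j k l * x i * x' j * y k * y' l

/-- The value of the 2-tensor `N` on `x, x'`, complex linear in each; the sesquilinear form is
obtained for `x'` a complex conjugate. -/
def sesq (N : Fin 2 → Fin 2 → ℂ) (x x' : Fin 2 → ℂ) : ℂ := ∑ i, ∑ j, N i j * x i * x' j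

/-- The expansion of the quartic form on `x + t y`, `x' + s y'`; only the coefficients of the pure
monomials `t²` and `s²` are made explicit. -/
theorem quad_add_smul (S : Fin 2 → Fin 2 → Fin 2 → Fin 2 → ℂ) (x x' y y' : Fin 2 → ℂ) :
    ∃ c00 c10 c01 c11 c21 c12 c22 : ℂ, ∀ t s : ℂ,
      quad S (fun i => x i + t * y i) (fun i => x' i + s * y' i) (fun i => x i + t * y i)
        (fun i => x' i + s * y' i) = c00 + t * c10 + s * c01 + t * s * c11 +
          t ^ 2 * quad S y x' y x' + s ^ 2 * quad S x y' x y' + t ^ 2 * s * c21 + t * s ^ 2 * c12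
          + t ^ 2 * s ^ 2 * c22 := by
  refine ⟨quad S x x' x x', quad S x x' y x' + quad S y x' x x',
    quad S x x' x y' + quad S x y' x x',
    quad S y y' x x' + quad S y x' x y' + quad S x y' y x' + quad S x x' y y',
    quad S y y' y x' + quad S y x' y y', quad S y y' x y' + quad S x y' y y', quad S y y' y y',
    fun t s => ?_⟩
  simp only [quad, Finset.mul_sum, ← Finset.sum_add_distrib]
  refine Finset.sum_congr rfl fun i _ => Finset.sum_congr rfl fun j _ =>
    Finset.sum_congr rfl fun k _ => Finset.sum_congr rfl fun l _ => ?_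
  ring

theorem sesq_add_smul (N : Fin 2 → Fin 2 → ℂ) (x x' y y' : Fin 2 → ℂ) (t s : ℂ) :
    sesq N (fun i => x i + t * y i) (fun i => x' i + s * y' i) =
      sesq N x x' + t * sesq N y x' + s * sesq N x y' + t * s * sesq N y y' := by
  simp only [sesq, Finset.mul_sum, ← Finset.sum_add_distrib]
  refine Finset.sum_congr rfl fun i _ => Finset.sum_congr rfl fun j _ => ?_
  ring

/-- If the quartic form of `S` is the product of two sesquilinear forms `N`, `E`, and `X`, `Y` are
orthogonal for `N`, then on `X + t Y` with `|t| = 1` the factor of `N` does not depend on `t`, and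
that of `E` is of degree at most one in `t` and `t̄`. So the parts of degree two of `S` vanish.
Since `t⁴ = 1` at the four points used, `t²` and `t̄²` are not separated, and the sum of the two
parts is obtained. -/
theorem quad_add_quad_eq_zero {S : Fin 2 → Fin 2 → Fin 2 → Fin 2 → ℂ} {N E : Fin 2 → Fin 2 → ℂ}
    (hS : ∀ X : Fin 2 → ℂ, quad S X (star X) X (star X) =
      sesq N X (star X) * sesq E X (star X))
    {X Y : Fin 2 → ℂ} (h1 : sesq N X (star Y) = 0) (h2 : sesq N Y (star X) = 0) :
    quad S X (star Y) X (star Y) + quad S Y (star X) Y (star X) = 0 := by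
  obtain ⟨c00, c10, c01, c11, c21, c12, c22, hc⟩ := quad_add_smul S X (star X) Y (star Y)
  have key : ∀ t s ε : ℂ, s = star t → t * s = 1 → t ^ 2 = ε → s ^ 2 = ε →
      c00 + t * c10 + s * c01 + c11 + ε * quad S Y (star X) Y (star X) +
        ε * quad S X (star Y) X (star Y) + t * c21 + s * c12 + c22 =
      (sesq N X (star X) + sesq N Y (star Y)) *
        (sesq E X (star X) + t * sesq E Y (star X) + s * sesq E X (star Y) +
          sesq E Y (star Y)) := by
    intro t s ε hst hts ht hs
    have h := hS fun i => X i + t * Y i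
    have hstar : (star fun i => X i + t * Y i) = fun i => star X i + s * star Y i := by
      ext i
      simp [hst]
    rw [hstar, hc, sesq_add_smul, sesq_add_smul, h1, h2] at h
    rw [show t ^ 2 * s * c21 = t * (t * s) * c21 by ring,
      show t * s ^ 2 * c12 = (t * s) * s * c12 by ring,
      show t ^ 2 * s ^ 2 * c22 = (t * s) * (t * s) * c22 by ring, hts, ht, hs] at h
    linear_combination h
  -- The sum of the values at `t = 1, -1` minus those at `t = i, -i` isolates the degrees `±2`.
  have e1 := key 1 1 1 (by simp) (by simp) (by simp) (by simp)
  have e2 := key (-1) (-1) 1 (by simp) (by simp) (by simp) (by simp)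
  have e3 := key Complex.I (-Complex.I) (-1) (by simp) (by simp) (by simp) (by simp)
  have e4 := key (-Complex.I) Complex.I (-1) (by simp) (by simp) (by simp) (by simp)
  linear_combination (e1 + e2 - e3 - e4) / 4

/-- If the quartic form of `S` is the product of two sesquilinear forms, then `S(X, Ȳ, X, Ȳ)`
vanishes for `X` and `Y` orthogonal for the first of them. -/
theorem quad_eq_zero {S : Fin 2 → Fin 2 → Fin 2 → Fin 2 → ℂ} {N E : Fin 2 → Fin 2 → ℂ}
    (hS : ∀ X : Fin 2 → ℂ, quad S X (star X) X (star X) =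
      sesq N X (star X) * sesq E X (star X))
    {X Y : Fin 2 → ℂ} (h1 : sesq N X (star Y) = 0) (h2 : sesq N Y (star X) = 0) :
    quad S X (star Y) X (star Y) = 0 := by
  have e1 := quad_add_quad_eq_zero hS h1 h2
  -- Multiplying `Y` by `1 + i` multiplies the two terms by `-2i` and by `2i`.
  have e2 := quad_add_quad_eq_zero hS (X := X) (Y := (1 + Complex.I) • Y)
    (by
      rw [show sesq N X (star ((1 + Complex.I) • Y)) = (1 - Complex.I) * sesq N X (star Y) by
        simp [sesq]; ring, h1, mul_zero])
    (by
      rw [show sesq N ((1 + Complex.I) • Y) (star X) = (1 + Complex.I) * sesq N Y (star X) by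
        simp [sesq]; ring, h2, mul_zero])
  have e3 : quad S X (star ((1 + Complex.I) • Y)) X (star ((1 + Complex.I) • Y)) =
      (1 - Complex.I) ^ 2 * quad S X (star Y) X (star Y) := by
    simp [quad]; ring
  have e4 : quad S ((1 + Complex.I) • Y) (star X) ((1 + Complex.I) • Y) (star X) =
      (1 + Complex.I) ^ 2 * quad S Y (star X) Y (star X) := by
    simp [quad]; ring
  have hI : Complex.I ^ 2 = -1 := Complex.I_sq
  have hp : (1 + Complex.I) ^ 2 = 2 * Complex.I := by linear_combination hI
  have hm : (1 - Complex.I) ^ 2 = - (2 * Complex.I) := by linear_combination hI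
  rw [e3, e4, hp, hm] at e2
  have e5 : 4 * Complex.I * quad S X (star Y) X (star Y) = 0 := by
    linear_combination 2 * Complex.I * e1 - e2
  simpa using e5

/-- For a metric of constant mixed curvature, the Chern curvature `R(X, Ȳ, X, Ȳ)` of orthogonal
vectors vanishes. -/
theorem IsUnitaryFrame.chernForm_eq_zero {g : HermitianMetric M} {x : M} {u v : C2} {r : ℝ}
    (h : g.IsUnitaryFrame x u v r) {k : ℕ} {α β : ℝ} (hβ : β ≠ 0) {c : ℂ}
    (hc : ∀ X : C2, X ≠ 0 → g.mixedCurv k α β x X = c) : g.chernForm x u v = 0 := by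
  have hz := mem_chart_target C2 x
  have hβ' : (β : ℂ) ≠ 0 := by exact_mod_cast hβ
  have hN : ∀ X Y : C2, sesq (g.hermMatrix x (chartAt C2 x x)) X (star Y) =
      hermForm (g.metricForm x (chartAt C2 x x)) X Y := by
    intro X Y
    rw [← sum_sum_hermForm]
    simp only [sesq, hermMatrix_apply, Pi.star_apply]
    refine Finset.sum_congr rfl fun i _ => Finset.sum_congr rfl fun j _ => ?_
    ring
  have hNX : ∀ X : C2, g.normSq x X = hermForm (g.metricForm x (chartAt C2 x x)) X X := fun X =>
    hN X X
  have hpos : ∀ X : C2, X ≠ 0 → g.normSq x X ≠ 0 := by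
    intro X hX
    have h1 := g.metricForm_self_smul_I x hz X
    have h2 : g.metricForm x (chartAt C2 x x) (Complex.I • X) X = 0 := by
      rw [metricForm_symm, h1]
    rw [hNX, hermForm, h1, h2, g.metricForm_smul_I x hz]
    have h3 : (g.metricForm x (chartAt C2 x x) X X : ℂ) ≠ 0 := by
      exact_mod_cast (g.metricForm_pos x hz hX).ne'
    simpa [← two_mul] using h3
  have hq := quad_eq_zero (S := g.chernCurv x) (N := g.hermMatrix x (chartAt C2 x x))
    (E := fun i j => (c * g.hermMatrix x (chartAt C2 x x) i j - α * g.chernRicci k x i j) / β)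
    (X := u) (Y := v) ?_ ?_ ?_
  · exact hq
  · intro X
    rcases eq_or_ne X 0 with rfl | hX
    · simp [quad, sesq]
    have h1 := hc (WithLp.toLp 2 X) (by simpa using hX)
    have h2 := hpos (WithLp.toLp 2 X) (by simpa using hX)
    have h3 : sesq (fun i j => (c * g.hermMatrix x (chartAt C2 x x) i j -
        α * g.chernRicci k x i j) / β) X (star X) =
        (c * g.normSq x (WithLp.toLp 2 X) - α * g.ricciForm k x (WithLp.toLp 2 X)) / β := by
      simp only [sesq, normSq, ricciForm, Fin.sum_univ_two, Pi.star_apply]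
      ring
    rw [h3, show sesq (g.hermMatrix x (chartAt C2 x x)) X (star X) =
      g.normSq x (WithLp.toLp 2 X) from rfl]
    rw [mixedCurv, holSecCurv, show (∑ i, ∑ j, ∑ k, ∑ l, g.chernCurv x i j k l *
      (WithLp.toLp 2 X : C2) i * star ((WithLp.toLp 2 X : C2) j) * (WithLp.toLp 2 X : C2) k *
      star ((WithLp.toLp 2 X : C2) l)) = quad (g.chernCurv x) X (star X) X (star X) from rfl] at h1
    field_simp at h1 ⊢
    linear_combination h1
  · rw [hN]
    simpa using h.hermForm_frame 0 1
  · rw [hN]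
    simpa using h.hermForm_frame 1 0

/-! ### Comparison of the Chern and the Levi-Civita curvature -/

/-- The Levi-Civita counterpart of `chernForm`: the real part of `4 R(X ∧ Ȳ, c ∧ d)`, for the
`(1, 0)`-vectors `X`, `Y` of `u`, `v`. -/
def curvRe (g : HermitianMetric M) (x : M) (u v c d : C2) : ℝ :=
  g.curvForm x u v c d + g.curvForm x (Complex.I • u) (Complex.I • v) c d

/-- The imaginary part of `4 R(X ∧ Ȳ, c ∧ d)`, for the `(1, 0)`-vectors `X`, `Y` of `u`, `v`. -/
def curvIm (g : HermitianMetric M) (x : M) (u v c d : C2) : ℝ :=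
  g.curvForm x u (Complex.I • v) c d - g.curvForm x (Complex.I • u) v c d

set_option maxHeartbeats 1000000 in
/-- `R(X, Ȳ, X, Ȳ)` is the same for the Levi-Civita and the Chern connection, up to the sign that
comes from the convention `R_{abcd} = g(∂_a, R(∂_c, ∂_d) ∂_b)` for the former; the left-hand side is
`16` times the Levi-Civita value, by the pair symmetry in the imaginary part.

In a unitary frame `E₁ = X`, `E₂ = Y` both have the second-order term `∂_X ∂_Ȳ g(X, Ȳ)`. The product
`Γ(·; X, X) Γ(·; Ȳ, Ȳ)` is the quadratic term of the Chern curvature, since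
`Γ(W; X, X) = ∂_X g(X, W)`. The product `Γ(·; X, Ȳ) Γ(·; X, Ȳ)`, which carries the torsion, is a sum
of the terms `Γ(E_k; X, Ȳ) Γ(Ē_k; X, Ȳ)`, and vanishes as `Γ(X; X, Ȳ) = Γ(Ȳ; X, Ȳ) = 0`. -/
theorem IsUnitaryFrame.curv_eq_chernForm {g : HermitianMetric M} {x : M} {u v : C2} {r : ℝ}
    (h : g.IsUnitaryFrame x u v r) :
    (g.curvRe x u v u v + g.curvRe x u v (Complex.I • u) (Complex.I • v)
      - g.curvIm x u v u (Complex.I • v) + g.curvIm x u v (Complex.I • u) v : ℝ) +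
    Complex.I * (2 * (g.curvRe x u v u (Complex.I • v) - g.curvRe x u v (Complex.I • u) v) : ℝ) =
      - 16 * g.chernForm x u v := by
  have hz := mem_chart_target C2 x
  have a1 : ∀ w a b, g.metricD1 x (chartAt C2 x x) w (Complex.I • a) b =
      - g.metricD1 x (chartAt C2 x x) w a (Complex.I • b) := by
    intro w a b
    rw [← g.metricD1_smul_I x hz w a, I_smul_I_smul, map_neg, neg_neg]
  have a2 : ∀ w a, g.metricD1 x (chartAt C2 x x) w a (Complex.I • a) = 0 := by
    intro w a
    have := a1 w a a
    rw [g.metricD1_symm x hz] at this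
    linarith
  have a3 : ∀ w, g.metricD1 x (chartAt C2 x x) w v u = g.metricD1 x (chartAt C2 x x) w u v :=
    fun w => g.metricD1_symm x hz w v u
  have a4 : ∀ w, g.metricD1 x (chartAt C2 x x) w v (Complex.I • u) =
      - g.metricD1 x (chartAt C2 x x) w u (Complex.I • v) := by
    intro w
    rw [g.metricD1_symm x hz, a1]
  have b1 : ∀ w w' a b, g.metricD2 x (chartAt C2 x x) w w' (Complex.I • a) b =
      - g.metricD2 x (chartAt C2 x x) w w' a (Complex.I • b) := by
    intro w w' a b
    rw [← g.metricD2_smul_I x hz w w' a, I_smul_I_smul, map_neg, neg_neg]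
  have b2 : ∀ w w' a, g.metricD2 x (chartAt C2 x x) w w' a (Complex.I • a) = 0 := by
    intro w w' a
    have := b1 w w' a a
    rw [g.metricD2_symm x hz] at this
    linarith
  have b3 : ∀ w w', g.metricD2 x (chartAt C2 x x) w w' v u =
      g.metricD2 x (chartAt C2 x x) w w' u v := fun w w' => g.metricD2_symm x hz w w' v u
  have b4 : ∀ w w', g.metricD2 x (chartAt C2 x x) w w' v (Complex.I • u) =
      - g.metricD2 x (chartAt C2 x x) w w' u (Complex.I • v) := by
    intro w w'
    rw [g.metricD2_symm x hz, b1]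
  -- The identities `a`, `b` and `c` bring all derivatives of the metric into a normal form.
  have c1 := g.metricD2_comm x hz v u
  have c2 := g.metricD2_comm x hz (Complex.I • v) u
  have c3 := g.metricD2_comm x hz (Complex.I • v) (Complex.I • u)
  have c4 := g.metricD2_comm x hz v (Complex.I • u)
  have c5 := g.metricD2_comm x hz (Complex.I • u) u
  have c6 := g.metricD2_comm x hz (Complex.I • v) v
  rw [h.chernForm_eq]
  simp only [curvRe, curvIm, h.curvForm_eq, Fin.sum_univ_four, christoffelLow, frame,
    Matrix.cons_val, a1, a2, a3, a4, b1, b2, b3, b4,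
    I_smul_I_smul, map_neg, neg_neg, neg_zero,
    wirt, wirtBar, hermD1, hermD2Bar, hermForm, hermFormL_apply, smul_apply, add_apply,
    ContinuousLinearMap.comp_apply, ContinuousLinearMap.flip_apply, c1, c2, c3, c4, c5, c6]
  rw [show (2 / r : ℂ) = ((2 * r⁻¹ : ℝ) : ℂ) by push_cast; rw [div_eq_mul_inv],
    show (1 / 2 : ℂ) = ((1 / 2 : ℝ) : ℂ) by norm_num,
    show (1 / 4 : ℂ) = ((1 / 4 : ℝ) : ℂ) by norm_num, show (-16 : ℂ) = ((-16 : ℝ) : ℂ) by norm_num]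
  clear a1 a2 a3 a4 b1 b2 b3 b4 c1 c2 c3 c4 c5 c6
  apply Complex.ext
  · simp only [Complex.add_re, Complex.sub_re, Complex.mul_re, Complex.add_im, Complex.sub_im,
      Complex.mul_im, Complex.neg_re, Complex.neg_im, Complex.ofReal_re, Complex.ofReal_im,
      Complex.I_re, Complex.I_im, mul_zero, zero_mul, one_mul, sub_zero, add_zero, zero_add,
      zero_sub, smul_eq_mul]
    ring
  · simp only [Complex.add_re, Complex.sub_re, Complex.mul_re, Complex.add_im, Complex.sub_im,
      Complex.mul_im, Complex.neg_re, Complex.neg_im, Complex.ofReal_re, Complex.ofReal_im,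
      Complex.I_re, Complex.I_im, mul_zero, zero_mul, one_mul, sub_zero, add_zero, zero_add,
      zero_sub, smul_eq_mul]
    ring

/-! ### Anti-self-duality in an orthonormal frame -/

/-- Rotating a unitary frame by the real matrix `(1, 1; -1, 1)`. -/
theorem IsUnitaryFrame.rotate {g : HermitianMetric M} {x : M} {u v : C2} {r : ℝ}
    (h : g.IsUnitaryFrame x u v r) : g.IsUnitaryFrame x (u + v) (v - u) (2 * r) := by
  have hf := h.metricForm_frame
  have h1 := hf 0 0
  have h2 := hf 2 2
  have h3 := hf 0 2
  have h4 := hf 2 0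
  have h5 := hf 0 1
  have h6 := hf 2 3
  have h7 := hf 0 3
  have h8 := hf 2 1
  simp [frame] at h1 h2 h3 h4 h5 h6 h7 h8
  constructor
  · linarith [h.pos]
  all_goals
    simp only [map_add, map_sub, smul_sub, add_apply, sub_apply, h1, h2, h3, h4, h5, h6,
      h7, h8]
    ring

/-- Rotating a unitary frame by the complex matrix `(1, i; i, 1)`. -/
theorem IsUnitaryFrame.rotate_I {g : HermitianMetric M} {x : M} {u v : C2} {r : ℝ}
    (h : g.IsUnitaryFrame x u v r) :
    g.IsUnitaryFrame x (u + Complex.I • v) (v + Complex.I • u) (2 * r) := by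
  have hf := h.metricForm_frame
  have e (i j : Fin 4) (hij : i ≠ j) := (hf i j).trans (if_neg hij)
  have d (i : Fin 4) := (hf i i).trans (if_pos rfl)
  have h00 := d 0
  have h11 := d 1
  have h22 := d 2
  have h33 := d 3
  have h03 := e 0 3 (by decide)
  have h30 := e 3 0 (by decide)
  have h21 := e 2 1 (by decide)
  have h12 := e 1 2 (by decide)
  have h02 := e 0 2 (by decide)
  have h01 := e 0 1 (by decide)
  have h32 := e 3 2 (by decide)
  have h31 := e 3 1 (by decide)
  simp only [frame, Matrix.cons_val] at h00 h11 h22 h33 h03 h30 h21 h12 h02 h01 h32 h31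
  constructor
  · linarith [h.pos]
  all_goals
    simp only [map_add, map_neg, add_apply, smul_add, I_smul_I_smul, h00, h11, h22, h33, h03, h30,
      h21, h12, h02, h01, h32, h31]
    ring

/-- The components of the curvature tensor in the real frame `u, Ju, v, Jv`. -/
def curvFrame (g : HermitianMetric M) (x : M) (u v : C2) (i j k l : Fin 4) : ℝ :=
  g.curvForm x (frame u v i) (frame u v j) (frame u v k) (frame u v l)

/-- The algebraic symmetries of a Riemannian curvature tensor, in components. -/
structure IsCurvature (T : Fin 4 → Fin 4 → Fin 4 → Fin 4 → ℝ) : Prop where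
  swap_left : ∀ i j k l, T j i k l = - T i j k l
  swap_right : ∀ i j k l, T i j l k = - T i j k l
  pair_symm : ∀ i j k l, T k l i j = T i j k l
  bianchi : ∀ i j k l, T i j k l + T i k l j + T i l j k = 0

/-- The curvature operator of `T`, compressed to the anti-self-dual 2-forms, is a multiple of the
identity. It is written in the orthogonal basis `a = e₀₂ + e₁₃`, `b = e₀₃ - e₁₂`, `c = e₀₁ - e₂₃` of
these forms: the three off-diagonal entries vanish and the diagonal ones are equal. -/
structure IsScalarOnMinus (T : Fin 4 → Fin 4 → Fin 4 → Fin 4 → ℝ) : Prop where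
  ab : T 0 2 0 3 - T 0 2 1 2 + T 1 3 0 3 - T 1 3 1 2 = 0
  ac : T 0 2 0 1 - T 0 2 2 3 + T 1 3 0 1 - T 1 3 2 3 = 0
  bc : T 0 3 0 1 - T 0 3 2 3 - T 1 2 0 1 + T 1 2 2 3 = 0
  aa_bb : T 0 2 0 2 + 2 * T 0 2 1 3 + T 1 3 1 3 = T 0 3 0 3 - 2 * T 0 3 1 2 + T 1 2 1 2
  aa_cc : T 0 2 0 2 + 2 * T 0 2 1 3 + T 1 3 1 3 = T 0 1 0 1 - 2 * T 0 1 2 3 + T 2 3 2 3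

theorem IsUnitaryFrame.isCurvature {g : HermitianMetric M} {x : M} {u v : C2} {r : ℝ}
    (h : g.IsUnitaryFrame x u v r) : IsCurvature (g.curvFrame x u v) where
  swap_left _ _ _ _ := h.curvForm_swap_left _ _ _ _
  swap_right _ _ _ _ := h.curvForm_swap_right _ _ _ _
  pair_symm _ _ _ _ := h.curvForm_pair_symm _ _ _ _
  bianchi _ _ _ _ := h.curvForm_bianchi _ _ _ _

theorem IsUnitaryFrame.curvRe_curvIm_eq_zero {g : HermitianMetric M} {x : M} {u v : C2} {r : ℝ}
    (h : g.IsUnitaryFrame x u v r) (hc : g.chernForm x u v = 0) :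
    g.curvRe x u v u v + g.curvRe x u v (Complex.I • u) (Complex.I • v)
      - g.curvIm x u v u (Complex.I • v) + g.curvIm x u v (Complex.I • u) v = 0 ∧
    g.curvRe x u v u (Complex.I • v) - g.curvRe x u v (Complex.I • u) v = 0 := by
  have h1 := h.curv_eq_chernForm
  rw [hc, mul_zero] at h1
  have h2 := congrArg Complex.re h1
  have h3 := congrArg Complex.im h1
  simp only [Complex.add_re, Complex.add_im, Complex.mul_re, Complex.mul_im, Complex.ofReal_re,
    Complex.ofReal_im, Complex.I_re, Complex.I_im, Complex.zero_re, Complex.zero_im] at h2 h3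
  constructor <;> linarith

/-- In the basis `a`, `b`, `c` of `IsScalarOnMinus`, the real and imaginary parts of `X ∧ Ȳ` are
proportional to `a` and `b`, so that `R(X, Ȳ, X, Ȳ) = 0` says `R(a, a) = R(b, b)` and `R(a, b) = 0`.
The frame `(u + v, v - u)` replaces `(a, b)` by `(a, -c)`, and `(u + iv, v + iu)` replaces it by
`(c, b)`, up to the factor two. -/
theorem IsUnitaryFrame.isScalarOnMinus {g : HermitianMetric M} {x : M} {u v : C2} {r : ℝ}
    (h : g.IsUnitaryFrame x u v r)
    (hc : ∀ (u v : C2) (r : ℝ), g.IsUnitaryFrame x u v r → g.chernForm x u v = 0) :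
    IsScalarOnMinus (g.curvFrame x u v) := by
  have hadd := h.curvForm_add
  have hneg : ∀ a b c d, g.curvForm x (-a) b c d = - g.curvForm x a b c d := by
    intro a b c d
    simpa using h.curvForm_smul (-1) a b c d
  have hadd2 : ∀ a b b' c d, g.curvForm x a (b + b') c d =
      g.curvForm x a b c d + g.curvForm x a b' c d := by
    intro a b b' c d
    rw [h.curvForm_swap_left, hadd, h.curvForm_swap_left a b, h.curvForm_swap_left a b']
    ring
  have hneg2 : ∀ a b c d, g.curvForm x a (-b) c d = - g.curvForm x a b c d := by
    intro a b c d
    rw [h.curvForm_swap_left, hneg, h.curvForm_swap_left a b, neg_neg]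
  have hadd3 : ∀ a b c c' d, g.curvForm x a b (c + c') d =
      g.curvForm x a b c d + g.curvForm x a b c' d := by
    intro a b c c' d
    rw [← h.curvForm_pair_symm, hadd, h.curvForm_pair_symm a b, h.curvForm_pair_symm a b]
  have hneg3 : ∀ a b c d, g.curvForm x a b (-c) d = - g.curvForm x a b c d := by
    intro a b c d
    rw [← h.curvForm_pair_symm, hneg, h.curvForm_pair_symm]
  have hadd4 : ∀ a b c d d', g.curvForm x a b c (d + d') =
      g.curvForm x a b c d + g.curvForm x a b c d' := by
    intro a b c d d'
    rw [← h.curvForm_pair_symm, hadd2, h.curvForm_pair_symm a b, h.curvForm_pair_symm a b]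
  have hneg4 : ∀ a b c d, g.curvForm x a b c (-d) = - g.curvForm x a b c d := by
    intro a b c d
    rw [← h.curvForm_pair_symm, hneg2, h.curvForm_pair_symm]
  have hzero : ∀ a c d, g.curvForm x a a c d = 0 := by
    intro a c d
    have := h.curvForm_swap_left a a c d
    linarith
  have hzero2 : ∀ a c d, g.curvForm x c d a a = 0 := by
    intro a c d
    rw [h.curvForm_pair_symm, hzero]
  obtain ⟨k1, k2⟩ := h.curvRe_curvIm_eq_zero (hc _ _ _ h)
  obtain ⟨k3, k4⟩ := h.rotate.curvRe_curvIm_eq_zero (hc _ _ _ h.rotate)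
  obtain ⟨k5, k6⟩ := h.rotate_I.curvRe_curvIm_eq_zero (hc _ _ _ h.rotate_I)
  simp only [curvRe, curvIm, smul_add, smul_sub, I_smul_I_smul] at k1 k2 k3 k4 k5 k6
  have s1 := h.curvForm_swap_left u (Complex.I • u)
  have s2 := h.curvForm_swap_left u v
  have s3 := h.curvForm_swap_left u (Complex.I • v)
  have s4 := h.curvForm_swap_left (Complex.I • u) v
  have s5 := h.curvForm_swap_left (Complex.I • u) (Complex.I • v)
  have s6 := h.curvForm_swap_left v (Complex.I • v)
  have t1 := fun a b => h.curvForm_swap_right a b u (Complex.I • u)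
  have t2 := fun a b => h.curvForm_swap_right a b u v
  have t3 := fun a b => h.curvForm_swap_right a b u (Complex.I • v)
  have t4 := fun a b => h.curvForm_swap_right a b (Complex.I • u) v
  have t5 := fun a b => h.curvForm_swap_right a b (Complex.I • u) (Complex.I • v)
  have t6 := fun a b => h.curvForm_swap_right a b v (Complex.I • v)
  have p := h.curvForm_pair_symm
  -- Everything is expanded in the components of the curvature in the frame `u, Ju, v, Jv`.
  simp only [sub_eq_add_neg, hadd, hadd2, hadd3, hadd4, hneg, hneg2, hneg3, hneg4, hzero, hzero2,
    s1, s2, s3, s4, s5, s6, t1, t2, t3, t4, t5, t6] at k1 k2 k3 k4 k5 k6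
  have p1 := p u (Complex.I • u) v (Complex.I • v)
  have p2 := p u v (Complex.I • u) (Complex.I • v)
  have p3 := p u (Complex.I • v) (Complex.I • u) v
  have p4 := p u v u (Complex.I • v)
  have p5 := p u v (Complex.I • u) v
  have p6 := p (Complex.I • u) (Complex.I • v) u (Complex.I • v)
  have p7 := p (Complex.I • u) (Complex.I • v) (Complex.I • u) v
  have p8 := p u v u (Complex.I • u)
  have p9 := p u v v (Complex.I • v)
  have p10 := p (Complex.I • u) (Complex.I • v) u (Complex.I • u)
  have p11 := p (Complex.I • u) (Complex.I • v) v (Complex.I • v)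
  have p12 := p u (Complex.I • v) u (Complex.I • u)
  have p13 := p u (Complex.I • v) v (Complex.I • v)
  have p14 := p (Complex.I • u) v u (Complex.I • u)
  have p15 := p (Complex.I • u) v v (Complex.I • v)
  constructor <;> simp only [curvFrame, frame, Matrix.cons_val] <;> linarith

/-- The Ricci tensor of a curvature tensor, in an orthonormal frame. -/
def frameRicci (T : Fin 4 → Fin 4 → Fin 4 → Fin 4 → ℝ) (j l : Fin 4) : ℝ := ∑ i, T i j i l

/-- The scalar curvature of a curvature tensor, in an orthonormal frame. -/
def frameScal (T : Fin 4 → Fin 4 → Fin 4 → Fin 4 → ℝ) : ℝ := ∑ j, frameRicci T j j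

/-- The metric in an orthonormal frame. -/
def delta (i j : Fin 4) : ℝ := if i = j then 1 else 0

/-- The Weyl tensor of a curvature tensor, in an orthonormal frame. -/
def frameWeyl (T : Fin 4 → Fin 4 → Fin 4 → Fin 4 → ℝ) (i j k l : Fin 4) : ℝ :=
  T i j k l - (1 / 2 : ℝ) * (delta i k * frameRicci T j l - delta i l * frameRicci T j k
      - delta j k * frameRicci T i l + delta j l * frameRicci T i k)
    + frameScal T / 6 * (delta i k * delta j l - delta i l * delta j k)

/-- The Levi-Civita symbol is a quotient of two Vandermonde determinants. -/
theorem leviCivita_eq (a b c d : Fin 4) :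
    leviCivita a b c d =
      ((b.val : ℝ) - a.val) * (c.val - a.val) * (d.val - a.val) * (c.val - b.val) *
        (d.val - b.val) * (d.val - c.val) / 12 := by
  have h : Matrix.vandermonde (fun i => ((![a, b, c, d] i).val : ℝ)) =
      (Matrix.of fun i j : Fin 4 => if ![a, b, c, d] i = j then (1 : ℝ) else 0) *
        Matrix.vandermonde (fun i : Fin 4 => (i.val : ℝ)) := by
    ext i j
    simp [Matrix.mul_apply, Matrix.vandermonde_apply]
  have h1 := congrArg Matrix.det h
  rw [Matrix.det_mul, Matrix.det_vandermonde, Matrix.det_vandermonde] at h1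
  have h2 : ∀ w : Fin 4 → ℝ, ∏ i, ∏ j ∈ Finset.Ioi i, (w j - w i) =
      (w 1 - w 0) * (w 2 - w 0) * (w 3 - w 0) * (w 2 - w 1) * (w 3 - w 1) * (w 3 - w 2) := by
    intro w
    rw [Fin.prod_univ_four, show Finset.Ioi (0 : Fin 4) = {1, 2, 3} by decide,
      show Finset.Ioi (1 : Fin 4) = {2, 3} by decide, show Finset.Ioi (2 : Fin 4) = {3} by decide,
      show Finset.Ioi (3 : Fin 4) = ∅ by decide,
      Finset.prod_insert (by decide), Finset.prod_insert (by decide), Finset.prod_singleton,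
      Finset.prod_insert (by decide), Finset.prod_singleton, Finset.prod_singleton,
      Finset.prod_empty]
    ring
  rw [h2, h2] at h1
  simp only [Matrix.cons_val] at h1
  -- The Vandermonde determinant of `0, 1, 2, 3` is `12`.
  rw [h1, leviCivita]
  norm_num

theorem frameWeyl_swap_left {T : Fin 4 → Fin 4 → Fin 4 → Fin 4 → ℝ} (h : IsCurvature T)
    (i j k l : Fin 4) : frameWeyl T j i k l = - frameWeyl T i j k l := by
  simp only [frameWeyl, h.swap_left i j]
  ring

theorem frameWeyl_swap_right {T : Fin 4 → Fin 4 → Fin 4 → Fin 4 → ℝ} (h : IsCurvature T)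
    (i j k l : Fin 4) : frameWeyl T i j l k = - frameWeyl T i j k l := by
  simp only [frameWeyl, h.swap_right i j k l]
  ring

set_option maxHeartbeats 1000000 in
/-- The components `W(e₀₁ - e₂₃, ·)`, `W(e₀₂ + e₁₃, ·)` and `W(e₀₃ - e₁₂, ·)` of the Weyl tensor
vanish: a Weyl tensor is trace-free, so that its curvature operator commutes with the Hodge star,
and by the Bianchi identity the trace of this operator on the anti-self-dual forms vanishes. -/
theorem frameWeyl_minus {T : Fin 4 → Fin 4 → Fin 4 → Fin 4 → ℝ} (h : IsCurvature T)
    (hm : IsScalarOnMinus T) (k l : Fin 4) (hkl : k < l) :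
    frameWeyl T 0 1 k l = frameWeyl T 2 3 k l ∧ frameWeyl T 0 2 k l = - frameWeyl T 1 3 k l ∧
      frameWeyl T 0 3 k l = frameWeyl T 1 2 k l := by
  obtain ⟨m1, m2, m3, m4, m5⟩ := hm
  have z1 : ∀ i k l, T i i k l = 0 := fun i k l => by linarith [h.swap_left i i k l]
  have z2 : ∀ i k l, T k l i i = 0 := fun i k l => by linarith [h.swap_right k l i i]
  have s1 := h.swap_left 0 1
  have s2 := h.swap_left 0 2
  have s3 := h.swap_left 0 3
  have s4 := h.swap_left 1 2
  have s5 := h.swap_left 1 3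
  have s6 := h.swap_left 2 3
  have t1 := fun i j => h.swap_right i j 0 1
  have t2 := fun i j => h.swap_right i j 0 2
  have t3 := fun i j => h.swap_right i j 0 3
  have t4 := fun i j => h.swap_right i j 1 2
  have t5 := fun i j => h.swap_right i j 1 3
  have t6 := fun i j => h.swap_right i j 2 3
  have p1 := h.pair_symm 0 1 0 2
  have p2 := h.pair_symm 0 1 0 3
  have p3 := h.pair_symm 0 1 1 2
  have p4 := h.pair_symm 0 1 1 3
  have p5 := h.pair_symm 0 1 2 3
  have p6 := h.pair_symm 0 2 0 3
  have p7 := h.pair_symm 0 2 1 2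
  have p8 := h.pair_symm 0 2 1 3
  have p9 := h.pair_symm 0 2 2 3
  have p10 := h.pair_symm 0 3 1 2
  have p11 := h.pair_symm 0 3 1 3
  have p12 := h.pair_symm 0 3 2 3
  have p13 := h.pair_symm 1 2 1 3
  have p14 := h.pair_symm 1 2 2 3
  have p15 := h.pair_symm 1 3 2 3
  have b := h.bianchi 0 1 2 3
  simp only [t5, p1, p2, p3, p4, p11, p13] at m1 m2 m3 m4 m5 b
  have ric : ∀ j l, frameRicci T j l = T 0 j 0 l + T 1 j 1 l + T 2 j 2 l + T 3 j 3 l :=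
    fun j l => Fin.sum_univ_four _
  have r00 := ric 0 0
  have r01 := ric 0 1
  have r02 := ric 0 2
  have r03 := ric 0 3
  have r10 := ric 1 0
  have r11 := ric 1 1
  have r12 := ric 1 2
  have r13 := ric 1 3
  have r20 := ric 2 0
  have r21 := ric 2 1
  have r22 := ric 2 2
  have r23 := ric 2 3
  have r30 := ric 3 0
  have r31 := ric 3 1
  have r32 := ric 3 2
  have r33 := ric 3 3
  have sc : frameScal T = frameRicci T 0 0 + frameRicci T 1 1 + frameRicci T 2 2 +
    frameRicci T 3 3 := Fin.sum_univ_four _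
  simp only [z1, z2, s1, s2, s3, s4, s5, s6, t1, t2, t3, t4, t5, t6, p1, p2, p3, p4, p6, p7, p9,
    p11, p12, p13, p14, p15, neg_neg, zero_add, add_zero]
    at r00 r01 r02 r03 r10 r11 r12 r13 r20 r21 r22 r23 r30 r31 r32 r33
  rw [r00, r11, r22, r33] at sc
  have hd : ∀ i, delta i i = 1 := fun i => if_pos rfl
  have hd' : ∀ i j, i ≠ j → delta i j = 0 := fun i j hij => if_neg hij
  fin_cases k <;> fin_cases l <;> simp only [Fin.zero_eta, Fin.mk_one, Fin.reduceFinMk] at hkl ⊢ <;>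
    first
    | exact absurd hkl (by decide)
    | (refine ⟨?_, ?_, ?_⟩ <;>
        simp only [frameWeyl, hd, hd', ne_eq, Fin.reduceEq, not_false_eq_true, Fin.isValue, p1,
          p2, p3, p4, p5, p6, p7, p8, p9, p10, p11, p12, p13, p14, p15, r00, r01, r02, r03, r10,
          r11, r12, r13, r20, r21, r22, r23, r30, r31, r32, r33, sc] <;>
        linarith)

/-- In an orthonormal frame, a curvature tensor that is scalar on `Λ⁻` has self-dual Weyl tensor, `W
= ⋆W`. -/
theorem frameWeyl_eq_star {T : Fin 4 → Fin 4 → Fin 4 → Fin 4 → ℝ} (h : IsCurvature T)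
    (hm : IsScalarOnMinus T) (i j k l : Fin 4) :
    frameWeyl T i j k l = (1 / 2 : ℝ) * ∑ p, ∑ q, leviCivita i j p q * frameWeyl T p q k l := by
  have z : ∀ i, frameWeyl T i i k l = 0 := fun i => by linarith [frameWeyl_swap_left h i i k l]
  have s1 := frameWeyl_swap_left h 0 1 k l
  have s2 := frameWeyl_swap_left h 0 2 k l
  have s3 := frameWeyl_swap_left h 0 3 k l
  have s4 := frameWeyl_swap_left h 1 2 k l
  have s5 := frameWeyl_swap_left h 1 3 k l
  have s6 := frameWeyl_swap_left h 2 3 k l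
  obtain ⟨w1, w2, w3⟩ : frameWeyl T 0 1 k l = frameWeyl T 2 3 k l ∧
      frameWeyl T 0 2 k l = - frameWeyl T 1 3 k l ∧ frameWeyl T 0 3 k l = frameWeyl T 1 2 k l := by
    rcases lt_trichotomy k l with hkl | rfl | hkl
    · exact frameWeyl_minus h hm k l hkl
    · have z' : ∀ i j, frameWeyl T i j k k = 0 := fun i j => by
        linarith [frameWeyl_swap_right h i j k k]
      simp [z']
    · have w := frameWeyl_minus h hm l k hkl
      simpa only [frameWeyl_swap_right h _ _ l k, neg_inj] using w
  fin_cases i <;> fin_cases j <;>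
    simp only [Fin.sum_univ_four, leviCivita_eq, Fin.zero_eta, Fin.mk_one, Fin.reduceFinMk, z, s1,
      s2, s3, s4, s5, s6, w1, w2, w3] <;>
    norm_num <;> ring

/-! ### From orthonormal frames to coordinates -/

/-- The coordinate components of the tensor with components `T` in a frame, where `Q i a` is the
`i`th frame component of the `a`th coordinate vector. -/
def pull (Q : Matrix (Fin 4) (Fin 4) ℝ) (T : Fin 4 → Fin 4 → Fin 4 → Fin 4 → ℝ)
    (a b c d : Fin 4) : ℝ :=
  ∑ i, ∑ j, ∑ k, ∑ l, Q i a * Q j b * Q k c * Q l d * T i j k l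

/-- The coordinate components of the bilinear form with components `U` in a frame, where `Q i a` is
the `i`th frame component of the `a`th coordinate vector. -/
def pullForm (Q : Matrix (Fin 4) (Fin 4) ℝ) (U : Fin 4 → Fin 4 → ℝ) (a b : Fin 4) : ℝ :=
  ∑ i, ∑ j, Q i a * Q j b * U i j

/-- The index pattern is that of the first term of the Kulkarni–Nomizu product. -/
theorem pullForm_mul_pullForm (Q : Matrix (Fin 4) (Fin 4) ℝ) (S U : Fin 4 → Fin 4 → ℝ)
    (a b c d : Fin 4) :
    pullForm Q S a c * pullForm Q U b d = pull Q (fun i j k l => S i k * U j l) a b c d := by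
  rw [mul_comm]
  simp only [pullForm, pull, Finset.sum_mul, Finset.mul_sum]
  refine Finset.sum_congr rfl fun i _ => ?_
  rw [Finset.sum_comm]
  refine Finset.sum_congr rfl fun j _ => Finset.sum_congr rfl fun k _ =>
    Finset.sum_congr rfl fun l _ => ?_
  ring

theorem pull_swap_left (Q : Matrix (Fin 4) (Fin 4) ℝ) (T : Fin 4 → Fin 4 → Fin 4 → Fin 4 → ℝ)
    (a b c d : Fin 4) : pull Q T b a c d = pull Q (fun i j k l => T j i k l) a b c d := by
  simp only [pull]
  rw [Finset.sum_comm]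
  refine Finset.sum_congr rfl fun i _ => Finset.sum_congr rfl fun j _ =>
    Finset.sum_congr rfl fun k _ => Finset.sum_congr rfl fun l _ => ?_
  ring

theorem pull_swap_right (Q : Matrix (Fin 4) (Fin 4) ℝ) (T : Fin 4 → Fin 4 → Fin 4 → Fin 4 → ℝ)
    (a b c d : Fin 4) : pull Q T a b d c = pull Q (fun i j k l => T i j l k) a b c d := by
  simp only [pull]
  refine Finset.sum_congr rfl fun i _ => Finset.sum_congr rfl fun j _ => ?_
  rw [Finset.sum_comm]
  refine Finset.sum_congr rfl fun k _ => Finset.sum_congr rfl fun l _ => ?_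
  ring

theorem pullForm_eq (Q : Matrix (Fin 4) (Fin 4) ℝ) (U : Fin 4 → Fin 4 → ℝ) (a b : Fin 4) :
    pullForm Q U a b = (Q.transpose * Matrix.of U * Q) a b := by
  simp only [pullForm, Matrix.mul_apply, Matrix.transpose_apply, Matrix.of_apply, Finset.sum_mul]
  rw [Finset.sum_comm]
  refine Finset.sum_congr rfl fun i _ => Finset.sum_congr rfl fun j _ => ?_
  ring

theorem pull_eq_pullForm (Q : Matrix (Fin 4) (Fin 4) ℝ) (T : Fin 4 → Fin 4 → Fin 4 → Fin 4 → ℝ)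
    (a b c d : Fin 4) :
    pull Q T a b c d = pullForm Q (fun i j => pullForm Q (fun k l => T i j k l) c d) a b := by
  simp only [pull, pullForm, Finset.mul_sum]
  refine Finset.sum_congr rfl fun i _ => Finset.sum_congr rfl fun j _ =>
    Finset.sum_congr rfl fun k _ => Finset.sum_congr rfl fun l _ => ?_
  ring

/-- The inverse of the matrix of the frame `u, Ju, v, Jv`: its columns are the frame components of
the coordinate vectors. -/
def coframeMatrix (u v : C2) : Matrix (Fin 4) (Fin 4) ℝ := (frameMatrix u v)⁻¹

variable {g : HermitianMetric M} {x : M} {u v : C2}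

theorem IsUnitaryFrame.det_sq_mul_det (h : g.IsUnitaryFrame x u v 1) :
    (frameMatrix u v).det ^ 2 * (g.realMatrix x (chartAt C2 x x)).det = 1 := by
  have h1 := congrArg Matrix.det h.transpose_mul_mul
  rw [one_smul, Matrix.det_mul, Matrix.det_mul, Matrix.det_transpose, Matrix.det_one] at h1
  linarith

theorem IsUnitaryFrame.isUnit_det (h : g.IsUnitaryFrame x u v 1) :
    IsUnit (frameMatrix u v).det := by
  rw [isUnit_iff_ne_zero]
  intro h0
  have := h.det_sq_mul_det
  rw [h0] at this
  norm_num at this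

/-- The frame `u, Ju, v, Jv` is positively oriented: its determinant is `|u₁ v₂ - u₂ v₁|²`. -/
theorem det_frameMatrix_nonneg (u v : C2) : 0 ≤ (frameMatrix u v).det := by
  have h : (frameMatrix u v).det = Complex.normSq (u 0 * v 1 - u 1 * v 0) := by
    rw [Matrix.det_succ_row_zero, Fin.sum_univ_four]
    simp [Matrix.det_fin_three, frameMatrix, frame, realCoord, Fin.succAbove, Complex.normSq_apply]
    ring
  rw [h]
  exact Complex.normSq_nonneg _

/-- The frame has volume one, with the sign given by its orientation. -/
theorem IsUnitaryFrame.sqrt_det_mul (h : g.IsUnitaryFrame x u v 1) :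
    Real.sqrt (g.realMatrix x (chartAt C2 x x)).det * (frameMatrix u v).det = 1 := by
  have h1 := h.det_sq_mul_det
  have h0 := h.isUnit_det.ne_zero
  have h2 : (g.realMatrix x (chartAt C2 x x)).det = ((frameMatrix u v).det⁻¹) ^ 2 := by
    field_simp
    linarith
  rw [h2, Real.sqrt_sq (inv_nonneg.2 (det_frameMatrix_nonneg u v)), inv_mul_cancel₀ h0]

theorem IsUnitaryFrame.coframe_mul (h : g.IsUnitaryFrame x u v 1) :
    coframeMatrix u v * frameMatrix u v = 1 := Matrix.nonsing_inv_mul _ h.isUnit_det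

theorem IsUnitaryFrame.mul_coframe (h : g.IsUnitaryFrame x u v 1) :
    frameMatrix u v * coframeMatrix u v = 1 := Matrix.mul_nonsing_inv _ h.isUnit_det

theorem IsUnitaryFrame.realMatrix_eq (h : g.IsUnitaryFrame x u v 1) :
    g.realMatrix x (chartAt C2 x x) = (coframeMatrix u v).transpose * coframeMatrix u v := by
  have h1 := h.transpose_mul_mul
  rw [one_smul] at h1
  have h2 : (coframeMatrix u v).transpose * (frameMatrix u v).transpose = 1 := by
    rw [← Matrix.transpose_mul, h.mul_coframe, Matrix.transpose_one]
  calc g.realMatrix x (chartAt C2 x x)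
      = ((coframeMatrix u v).transpose * (frameMatrix u v).transpose) *
        g.realMatrix x (chartAt C2 x x) * (frameMatrix u v * coframeMatrix u v) := by
          rw [h2, h.mul_coframe, Matrix.one_mul, Matrix.mul_one]
    _ = (coframeMatrix u v).transpose * ((frameMatrix u v).transpose *
        (g.realMatrix x (chartAt C2 x x) * frameMatrix u v)) * coframeMatrix u v := by
          simp only [Matrix.mul_assoc]
    _ = _ := by rw [h1, Matrix.mul_one]

theorem IsUnitaryFrame.gDown_eq_pullForm (h : g.IsUnitaryFrame x u v 1) (a b : Fin 4) :
    g.gDown x a b = pullForm (coframeMatrix u v) delta a b := by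
  have h1 : Matrix.of delta = 1 := by
    ext i j
    simp [delta, Matrix.one_apply]
  rw [gDown, h.realMatrix_eq, pullForm_eq, h1, Matrix.mul_one]

theorem IsUnitaryFrame.gUp_eq (h : g.IsUnitaryFrame x u v 1) (a b : Fin 4) :
    g.gUp x a b = ∑ i, frameMatrix u v a i * frameMatrix u v b i := by
  rw [gUp, h.inv_realMatrix, inv_one, one_smul, Matrix.mul_apply]
  rfl

/-- Raising both indices, in terms of the frame. -/
theorem IsUnitaryFrame.sum_gUp_mul_gUp_mul (h : g.IsUnitaryFrame x u v 1)
    (U : Fin 4 → Fin 4 → ℝ) (p q : Fin 4) :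
    ∑ e, ∑ f, g.gUp x p e * g.gUp x q f * pullForm (coframeMatrix u v) U e f =
      pullForm (frameMatrix u v).transpose U p q := by
  have h1 : (g.realMatrix x (chartAt C2 x x))⁻¹ =
      frameMatrix u v * (frameMatrix u v).transpose := by
    rw [h.inv_realMatrix, inv_one, one_smul]
  have h2 : (frameMatrix u v).transpose * (coframeMatrix u v).transpose = 1 := by
    rw [← Matrix.transpose_mul, h.coframe_mul, Matrix.transpose_one]
  have h3 : ((g.realMatrix x (chartAt C2 x x))⁻¹ * ((coframeMatrix u v).transpose * Matrix.of U *
      coframeMatrix u v) * (g.realMatrix x (chartAt C2 x x))⁻¹.transpose) p q =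
      ∑ e, ∑ f, g.gUp x p e * g.gUp x q f * pullForm (coframeMatrix u v) U e f := by
    simp only [Matrix.mul_apply (M := (g.realMatrix x (chartAt C2 x x))⁻¹ * _),
      Matrix.mul_apply (M := (g.realMatrix x (chartAt C2 x x))⁻¹), ← pullForm_eq, gUp,
      Matrix.transpose_apply, Finset.sum_mul]
    rw [Finset.sum_comm]
    refine Finset.sum_congr rfl fun e _ => Finset.sum_congr rfl fun f _ => ?_
    ring
  rw [← h3, pullForm_eq, h1]
  refine congrFun (congrFun (?_ : _ = (_ : Matrix (Fin 4) (Fin 4) ℝ)) p) q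
  calc frameMatrix u v * (frameMatrix u v).transpose * ((coframeMatrix u v).transpose *
        Matrix.of U * coframeMatrix u v) * (frameMatrix u v * (frameMatrix u v).transpose).transpose
      = frameMatrix u v * ((frameMatrix u v).transpose * (coframeMatrix u v).transpose) *
        Matrix.of U * (coframeMatrix u v * frameMatrix u v) * (frameMatrix u v).transpose := by
        simp only [Matrix.mul_assoc, Matrix.transpose_mul, Matrix.transpose_transpose]
    _ = _ := by rw [h2, h.coframe_mul, Matrix.mul_one, Matrix.mul_one, Matrix.transpose_transpose]

theorem IsUnitaryFrame.sum_gUp_mul_pullForm (h : g.IsUnitaryFrame x u v 1)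
    (U : Fin 4 → Fin 4 → ℝ) :
    ∑ b, ∑ d, g.gUp x b d * pullForm (coframeMatrix u v) U b d = ∑ j, U j j := by
  have h1 : (coframeMatrix u v * frameMatrix u v).transpose * Matrix.of U *
      (coframeMatrix u v * frameMatrix u v) = Matrix.of U := by
    rw [h.coframe_mul]
    simp
  have h2 : ∀ j, U j j = pullForm (coframeMatrix u v * frameMatrix u v) U j j := by
    intro j
    rw [pullForm_eq, h1]
    rfl
  have h3 : ∀ j, U j j =
      pullForm (frameMatrix u v) (pullForm (coframeMatrix u v) U) j j := by
    intro j
    rw [h2, pullForm_eq, pullForm_eq]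
    have : Matrix.of (pullForm (coframeMatrix u v) U) =
        (coframeMatrix u v).transpose * Matrix.of U * coframeMatrix u v := by
      ext a b
      exact pullForm_eq _ _ _ _
    rw [this]
    simp only [Matrix.transpose_mul, Matrix.mul_assoc]
  simp only [h3]
  simp only [pullForm.eq_def (frameMatrix u v), h.gUp_eq, Finset.sum_mul]
  symm
  rw [Finset.sum_comm]
  refine Finset.sum_congr rfl fun b _ => ?_
  rw [Finset.sum_comm]

theorem frame_eq_sum (u v : C2) (i : Fin 4) :
    frame u v i = ∑ a, frameMatrix u v a i • realBasis a :=
  (sum_realCoord_smul _).symm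

theorem IsUnitaryFrame.realBasis_eq_sum (h : g.IsUnitaryFrame x u v 1) (a : Fin 4) :
    realBasis a = ∑ i, coframeMatrix u v i a • frame u v i := by
  simp only [frame_eq_sum, Finset.smul_sum, smul_smul]
  rw [Finset.sum_comm]
  have h1 : ∀ b, ∑ i, (coframeMatrix u v i a * frameMatrix u v b i) • realBasis b =
      (frameMatrix u v * coframeMatrix u v) b a • realBasis b := by
    intro b
    rw [← Finset.sum_smul, Matrix.mul_apply]
    simp only [mul_comm]
  simp only [h1, h.mul_coframe, Matrix.one_apply, ite_smul, one_smul, zero_smul]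
  simp

theorem IsUnitaryFrame.curvForm_sum_left (h : g.IsUnitaryFrame x u v 1) (t : Fin 4 → ℝ)
    (w : Fin 4 → C2) (b c d : C2) :
    g.curvForm x (∑ i, t i • w i) b c d = ∑ i, t i * g.curvForm x (w i) b c d := by
  simp only [Fin.sum_univ_four, h.curvForm_add, h.curvForm_smul]

theorem IsUnitaryFrame.curvForm_sum_two (h : g.IsUnitaryFrame x u v 1) (t : Fin 4 → ℝ)
    (w : Fin 4 → C2) (a c d : C2) :
    g.curvForm x a (∑ i, t i • w i) c d = ∑ i, t i * g.curvForm x a (w i) c d := by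
  rw [h.curvForm_swap_left, h.curvForm_sum_left, ← Finset.sum_neg_distrib]
  refine Finset.sum_congr rfl fun i _ => ?_
  rw [h.curvForm_swap_left a]
  ring

theorem IsUnitaryFrame.curvForm_sum_three (h : g.IsUnitaryFrame x u v 1) (t : Fin 4 → ℝ)
    (w : Fin 4 → C2) (a b d : C2) :
    g.curvForm x a b (∑ i, t i • w i) d = ∑ i, t i * g.curvForm x a b (w i) d := by
  rw [← h.curvForm_pair_symm, h.curvForm_sum_left]
  exact Finset.sum_congr rfl fun i _ => by rw [h.curvForm_pair_symm a b]

theorem IsUnitaryFrame.curvForm_sum_right (h : g.IsUnitaryFrame x u v 1) (t : Fin 4 → ℝ)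
    (w : Fin 4 → C2) (a b c : C2) :
    g.curvForm x a b c (∑ i, t i • w i) = ∑ i, t i * g.curvForm x a b c (w i) := by
  rw [← h.curvForm_pair_symm, h.curvForm_sum_two]
  exact Finset.sum_congr rfl fun i _ => by rw [h.curvForm_pair_symm a b]

theorem IsUnitaryFrame.riemann_eq_pull (h : g.IsUnitaryFrame x u v 1) (a b c d : Fin 4) :
    g.riemann x a b c d = pull (coframeMatrix u v) (g.curvFrame x u v) a b c d := by
  rw [riemann_eq_curvForm, h.realBasis_eq_sum a, h.realBasis_eq_sum b, h.realBasis_eq_sum c,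
    h.realBasis_eq_sum d]
  simp only [h.curvForm_sum_left, h.curvForm_sum_two, h.curvForm_sum_three, h.curvForm_sum_right,
    pull, curvFrame, Finset.mul_sum]
  refine Finset.sum_congr rfl fun i _ => Finset.sum_congr rfl fun j _ =>
    Finset.sum_congr rfl fun k _ => Finset.sum_congr rfl fun l _ => ?_
  ring

theorem riemannUp_eq_sum (g : HermitianMetric M) (x : M) (e b c d : Fin 4) :
    g.riemannUp x e b c d = ∑ a, g.gUp x e a * g.riemann x a b c d := by
  have h : (g.realMatrix x (chartAt C2 x x))⁻¹ * g.realMatrix x (chartAt C2 x x) = 1 :=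
    Matrix.nonsing_inv_mul _ (g.realMatrix_isUnit_det x (mem_chart_target C2 x))
  simp only [riemann, Finset.mul_sum, ← mul_assoc]
  rw [Finset.sum_comm]
  simp only [← Finset.sum_mul, gUp, gDown, ← Matrix.mul_apply, h, Matrix.one_apply]
  simp

theorem IsUnitaryFrame.ricci_eq_pullForm (h : g.IsUnitaryFrame x u v 1) (b d : Fin 4) :
    g.ricci x b d = pullForm (coframeMatrix u v) (frameRicci (g.curvFrame x u v)) b d := by
  have h1 : g.ricci x b d =
      ∑ i, g.curvForm x (frame u v i) (realBasis b) (frame u v i) (realBasis d) := by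
    simp only [ricci, riemannUp_eq_sum, riemann_eq_curvForm, h.gUp_eq]
    simp only [frame_eq_sum, h.curvForm_sum_left, h.curvForm_sum_three, Finset.sum_mul,
      Finset.mul_sum]
    rw [Finset.sum_comm]
    symm
    rw [Finset.sum_comm]
    refine Finset.sum_congr rfl fun a _ => ?_
    rw [Finset.sum_comm]
    refine Finset.sum_congr rfl fun c _ => Finset.sum_congr rfl fun i _ => ?_
    ring
  rw [h1, h.realBasis_eq_sum b, h.realBasis_eq_sum d]
  simp only [h.curvForm_sum_two, h.curvForm_sum_right, pullForm, frameRicci, curvFrame,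
    Finset.mul_sum]
  rw [Finset.sum_comm]
  refine Finset.sum_congr rfl fun j _ => ?_
  rw [Finset.sum_comm]
  refine Finset.sum_congr rfl fun l _ => Finset.sum_congr rfl fun i _ => ?_
  ring

theorem IsUnitaryFrame.scalarCurv_eq (h : g.IsUnitaryFrame x u v 1) :
    g.scalarCurv x = frameScal (g.curvFrame x u v) := by
  simp only [scalarCurv, h.ricci_eq_pullForm]
  exact h.sum_gUp_mul_pullForm _

theorem IsUnitaryFrame.weyl_eq_pull (h : g.IsUnitaryFrame x u v 1) (a b c d : Fin 4) :
    g.weyl x a b c d = pull (coframeMatrix u v) (frameWeyl (g.curvFrame x u v)) a b c d := by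
  simp only [weyl, h.riemann_eq_pull, h.scalarCurv_eq, h.gDown_eq_pullForm, h.ricci_eq_pullForm]
  -- The other index patterns come from the one of `pullForm_mul_pullForm` by transpositions.
  have e1 : ∀ S U : Fin 4 → Fin 4 → ℝ,
      pullForm (coframeMatrix u v) S a d * pullForm (coframeMatrix u v) U b c =
        pull (coframeMatrix u v) (fun i j k l => S i l * U j k) a b c d := fun S U => by
    rw [pullForm_mul_pullForm, pull_swap_right]
  have e2 : ∀ S U : Fin 4 → Fin 4 → ℝ,
      pullForm (coframeMatrix u v) S b c * pullForm (coframeMatrix u v) U a d =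
        pull (coframeMatrix u v) (fun i j k l => S j k * U i l) a b c d := fun S U => by
    rw [pullForm_mul_pullForm, pull_swap_left]
  have e3 : ∀ S U : Fin 4 → Fin 4 → ℝ,
      pullForm (coframeMatrix u v) S b d * pullForm (coframeMatrix u v) U a c =
        pull (coframeMatrix u v) (fun i j k l => S j l * U i k) a b c d := fun S U => by
    rw [pullForm_mul_pullForm, pull_swap_left, pull_swap_right]
  rw [e2, e3]
  simp only [e1, pullForm_mul_pullForm]
  simp only [pull, frameWeyl, Finset.mul_sum, ← Finset.sum_add_distrib, ← Finset.sum_sub_distrib]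
  refine Finset.sum_congr rfl fun i _ => Finset.sum_congr rfl fun j _ =>
    Finset.sum_congr rfl fun k _ => Finset.sum_congr rfl fun l _ => ?_
  ring

/-- The determinant of four vectors of `ℝ⁴`. -/
def vol4 (a b c d : Fin 4 → ℝ) : ℝ := Matrix.det (Matrix.of ![a, b, c, d])

theorem vol4_sum_zero (b c d t : Fin 4 → ℝ) (w : Fin 4 → Fin 4 → ℝ) :
    vol4 (∑ i, t i • w i) b c d = ∑ i, t i * vol4 (w i) b c d := by
  have h : ∀ z, vol4 z b c d = ((Matrix.of ![0, b, c, d]).updateRow 0 z).det := fun z => by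
    rw [vol4]
    congr 1
    ext i
    fin_cases i <;> rfl
  simp only [h, Fin.sum_univ_four, Matrix.det_updateRow_add, Matrix.det_updateRow_smul]

theorem vol4_sum_one (a c d t : Fin 4 → ℝ) (w : Fin 4 → Fin 4 → ℝ) :
    vol4 a (∑ i, t i • w i) c d = ∑ i, t i * vol4 a (w i) c d := by
  have h : ∀ z, vol4 a z c d = ((Matrix.of ![a, 0, c, d]).updateRow 1 z).det := fun z => by
    rw [vol4]
    congr 1
    ext i
    fin_cases i <;> rfl
  simp only [h, Fin.sum_univ_four, Matrix.det_updateRow_add, Matrix.det_updateRow_smul]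

theorem vol4_sum_two (a b d t : Fin 4 → ℝ) (w : Fin 4 → Fin 4 → ℝ) :
    vol4 a b (∑ i, t i • w i) d = ∑ i, t i * vol4 a b (w i) d := by
  have h : ∀ z, vol4 a b z d = ((Matrix.of ![a, b, 0, d]).updateRow 2 z).det := fun z => by
    rw [vol4]
    congr 1
    ext i
    fin_cases i <;> rfl
  simp only [h, Fin.sum_univ_four, Matrix.det_updateRow_add, Matrix.det_updateRow_smul]

theorem vol4_sum_three (a b c t : Fin 4 → ℝ) (w : Fin 4 → Fin 4 → ℝ) :
    vol4 a b c (∑ i, t i • w i) = ∑ i, t i * vol4 a b c (w i) := by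
  have h : ∀ z, vol4 a b c z = ((Matrix.of ![a, b, c, 0]).updateRow 3 z).det := fun z => by
    rw [vol4]
    congr 1
    ext i
    fin_cases i <;> rfl
  simp only [h, Fin.sum_univ_four, Matrix.det_updateRow_add, Matrix.det_updateRow_smul]

theorem leviCivita_eq_vol4 (a b c d : Fin 4) :
    leviCivita a b c d = vol4 (Pi.single a 1) (Pi.single b 1) (Pi.single c 1) (Pi.single d 1) := by
  rw [leviCivita, vol4]
  congr 1
  ext i j
  fin_cases i <;> simp [Pi.single_apply, eq_comm]

/-- The determinant of four columns of `P`. -/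
theorem vol4_columns (P : Matrix (Fin 4) (Fin 4) ℝ) (i j k l : Fin 4) :
    vol4 (fun p => P p i) (fun p => P p j) (fun p => P p k) (fun p => P p l) =
      leviCivita i j k l * P.det := by
  rw [leviCivita, ← Matrix.det_transpose P, ← Matrix.det_mul, vol4]
  have h : ∀ m n, ![fun p => P p i, fun p => P p j, fun p => P p k, fun p => P p l] m n =
      P n (![i, j, k, l] m) := by
    intro m n
    fin_cases m <;> rfl
  congr 1
  ext m n
  simp [Matrix.mul_apply, h]

/-- Multiplicativity of the determinant: contracting two indices of the Levi-Civita symbol with `P`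
is `det P` times contracting the other two with the inverse of `P`. -/
theorem sum_leviCivita_mul (P Q : Matrix (Fin 4) (Fin 4) ℝ) (hPQ : P * Q = 1) (a b i j : Fin 4) :
    ∑ p, ∑ q, leviCivita a b p q * P p i * P q j =
      P.det * ∑ m, ∑ n, Q m a * Q n b * leviCivita m n i j := by
  have h1 : ∀ i, (fun p => P p i) = ∑ p, P p i • (Pi.single p 1 : Fin 4 → ℝ) := by
    intro i
    ext q
    simp [Finset.sum_apply, Pi.single_apply]
  have h2 : ∀ a, (Pi.single a 1 : Fin 4 → ℝ) = ∑ m, Q m a • fun p => P p m := by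
    intro a
    ext q
    have := congrFun (congrFun hPQ q) a
    rw [Matrix.mul_apply, Matrix.one_apply] at this
    simp only [Finset.sum_apply, Pi.smul_apply, smul_eq_mul, Pi.single_apply]
    rw [← this]
    simp only [mul_comm]
  have h3 : ∑ p, ∑ q, leviCivita a b p q * P p i * P q j =
      vol4 (Pi.single a 1) (Pi.single b 1) (fun p => P p i) (fun p => P p j) := by
    rw [h1 i, h1 j, vol4_sum_two]
    simp only [vol4_sum_three, ← leviCivita_eq_vol4, Finset.mul_sum]
    refine Finset.sum_congr rfl fun p _ => Finset.sum_congr rfl fun q _ => ?_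
    ring
  rw [h3, h2 a, h2 b, vol4_sum_zero]
  simp only [vol4_sum_one, vol4_columns, Finset.mul_sum]
  refine Finset.sum_congr rfl fun p _ => Finset.sum_congr rfl fun q _ => ?_
  ring

theorem sum_comm_pairs (f : Fin 4 → Fin 4 → Fin 4 → Fin 4 → ℝ) :
    ∑ p, ∑ q, ∑ i, ∑ j, f p q i j = ∑ i, ∑ j, ∑ p, ∑ q, f p q i j := by
  simp only [Finset.sum_comm (f := fun q i => ∑ j, f _ q i j),
    Finset.sum_comm (f := fun q j => f _ q _ j)]
  rw [Finset.sum_comm]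
  exact Finset.sum_congr rfl fun i _ => Finset.sum_comm

/-- The Hodge star of a 2-form in terms of its components in a positive orthonormal frame. -/
theorem IsUnitaryFrame.hodgeStar_pullForm (h : g.IsUnitaryFrame x u v 1) (U : Fin 4 → Fin 4 → ℝ)
    (a b : Fin 4) :
    g.hodgeStar x (pullForm (coframeMatrix u v) U) a b =
      pullForm (coframeMatrix u v)
        (fun m n => (1 / 2 : ℝ) * ∑ i, ∑ j, leviCivita m n i j * U i j) a b := by
  have h1 : g.hodgeStar x (pullForm (coframeMatrix u v) U) a b =
      (1 / 2 : ℝ) * ∑ p, ∑ q, g.volForm x a b p q * pullForm (frameMatrix u v).transpose U p q := by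
    simp only [hodgeStar, ← h.sum_gUp_mul_gUp_mul, Finset.mul_sum, mul_assoc]
  have h2 : ∑ p, ∑ q, g.volForm x a b p q * pullForm (frameMatrix u v).transpose U p q =
      Real.sqrt (g.realMatrix x (chartAt C2 x x)).det * ∑ i, ∑ j, U i j *
        ∑ p, ∑ q, leviCivita a b p q * frameMatrix u v p i * frameMatrix u v q j := by
    simp only [volForm, pullForm, Matrix.transpose_apply, Finset.mul_sum]
    rw [sum_comm_pairs]
    refine Finset.sum_congr rfl fun i _ => Finset.sum_congr rfl fun j _ =>
      Finset.sum_congr rfl fun k _ => Finset.sum_congr rfl fun l _ => ?_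
    ring
  rw [h1, h2]
  simp only [sum_leviCivita_mul _ _ h.mul_coframe]
  have h3 : Real.sqrt (g.realMatrix x (chartAt C2 x x)).det * ∑ i, ∑ j, U i j *
      ((frameMatrix u v).det * ∑ m, ∑ n, coframeMatrix u v m a * coframeMatrix u v n b *
        leviCivita m n i j) = ∑ i, ∑ j, U i j * ∑ m, ∑ n, coframeMatrix u v m a *
          coframeMatrix u v n b * leviCivita m n i j := by
    rw [← one_mul (∑ i, ∑ j, U i j * ∑ m, ∑ n, coframeMatrix u v m a *
          coframeMatrix u v n b * leviCivita m n i j), ← h.sqrt_det_mul, mul_assoc, Finset.mul_sum]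
    simp only [Finset.mul_sum]
    refine Finset.sum_congr rfl fun i _ => Finset.sum_congr rfl fun j _ =>
      Finset.sum_congr rfl fun k _ => Finset.sum_congr rfl fun l _ => ?_
    ring
  rw [h3]
  simp only [pullForm, Finset.mul_sum]
  rw [sum_comm_pairs]
  refine Finset.sum_congr rfl fun i _ => Finset.sum_congr rfl fun j _ =>
    Finset.sum_congr rfl fun k _ => Finset.sum_congr rfl fun l _ => ?_
  ring

/-- Self-duality of the Weyl tensor in an orthonormal frame gives `W⁻ = 0` in coordinates, since the
Weyl tensor and the Hodge star are both related to their frame versions by the matrix of the frame.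
-/
theorem IsUnitaryFrame.weylMinus_eq_zero (h : g.IsUnitaryFrame x u v 1)
    (hm : IsScalarOnMinus (g.curvFrame x u v)) (a b c d : Fin 4) : g.weylMinus x a b c d = 0 := by
  have h1 : (fun e f => g.weyl x e f c d) = pullForm (coframeMatrix u v) (fun i j =>
      pullForm (coframeMatrix u v) (fun k l => frameWeyl (g.curvFrame x u v) i j k l) c d) := by
    ext e f
    rw [h.weyl_eq_pull, pull_eq_pullForm]
  have h2 : g.weyl x a b c d = _ := congrFun (congrFun h1 a) b
  rw [weylMinus, h1, h2, h.hodgeStar_pullForm]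
  have h3 : ∀ i j, pullForm (coframeMatrix u v)
      (fun k l => frameWeyl (g.curvFrame x u v) i j k l) c d =
      (1 / 2 : ℝ) * ∑ p, ∑ q, leviCivita i j p q * pullForm (coframeMatrix u v)
        (fun k l => frameWeyl (g.curvFrame x u v) p q k l) c d := by
    intro i j
    have h4 : ∀ k l, frameWeyl (g.curvFrame x u v) i j k l = _ := fun k l =>
      frameWeyl_eq_star h.isCurvature hm i j k l
    simp only [h4]
    simp only [pullForm, Finset.mul_sum]
    rw [sum_comm_pairs]
    refine Finset.sum_congr rfl fun i _ => Finset.sum_congr rfl fun j _ =>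
      Finset.sum_congr rfl fun k _ => Finset.sum_congr rfl fun l _ => ?_
    ring
  simp only [← h3, sub_self, mul_zero]

/-- Gram–Schmidt, for the Hermitian form, applied to the coordinate vectors `ex 0`, `ex 1`. -/
theorem exists_isUnitaryFrame (g : HermitianMetric M) (x : M) :
    ∃ u v, g.IsUnitaryFrame x u v 1 := by
  have hz := mem_chart_target C2 x
  have hJ := fun w => g.metricForm_self_smul_I x hz w
  have hnorm : ∀ w : C2, w ≠ 0 → ∃ s : ℝ, s ≠ 0 ∧
      g.metricForm x (chartAt C2 x x) (s • w) (s • w) = 1 := by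
    intro w hw
    have hp := g.metricForm_pos x hz hw
    refine ⟨(Real.sqrt (g.metricForm x (chartAt C2 x x) w w))⁻¹,
      inv_ne_zero (Real.sqrt_pos.2 hp).ne', ?_⟩
    simp only [map_smul, smul_apply, smul_eq_mul]
    rw [← mul_assoc, ← mul_inv, Real.mul_self_sqrt hp.le, inv_mul_cancel₀ hp.ne']
  obtain ⟨s, hs, hu⟩ := hnorm (ex 0) (fun h0 => by
    simpa [ex] using congrArg (fun w : C2 => w 0) h0)
  set u : C2 := s • ex 0 with hu_def
  have hu1 : u 1 = 0 := by simp [hu_def, ex]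
  set a := g.metricForm x (chartAt C2 x x) u (ex 1)
  set b := g.metricForm x (chartAt C2 x x) (Complex.I • u) (ex 1) with hb
  set w : C2 := ex 1 - a • u - b • (Complex.I • u) with hw
  have hw0 : w ≠ 0 := by
    intro h0
    have := congrArg (fun y : C2 => y 1) h0
    simp [hw, hu1, ex] at this
  have ho : g.metricForm x (chartAt C2 x x) u w = 0 := by
    simp only [hw, map_sub, map_smul, hu, hJ, smul_eq_mul]
    ring
  have ho' : g.metricForm x (chartAt C2 x x) u (Complex.I • w) = 0 := by
    rw [← neg_neg (g.metricForm x (chartAt C2 x x) u (Complex.I • w)),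
      ← g.metricForm_smul_I_left x hz]
    have h1 : g.metricForm x (chartAt C2 x x) (Complex.I • u) u = 0 := by
      rw [metricForm_symm, hJ]
    simp only [hw, map_sub, map_smul, g.metricForm_smul_I x hz, hu, h1, smul_eq_mul, ← hb]
    ring
  obtain ⟨t, ht, hv⟩ := hnorm w hw0
  refine ⟨u, t • w, one_pos, hu, hv, ?_, ?_⟩
  · rw [map_smul, ho, smul_zero]
  · rw [smul_comm, map_smul, ho', smul_zero]

end

end HermitianMetric

/-- Any compact Hermitian surface with constant `k`th-mixed curvature is self-dual. -/
theorem theorem1p1 {M : Type*} [TopologicalSpace M] [T2Space M] [CompactSpace M]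
    [ChartedSpace C2 M] [IsManifold 𝓘(ℂ, C2) ω M] (g : HermitianMetric M)
    (k : ℕ) (hk : k ∈ Finset.Icc 1 4) (α β : ℝ) (hβ : β ≠ 0) (c : ℂ)
    (hconst : ∀ (x : M) (X : C2), X ≠ 0 → g.mixedCurv k α β x X = c) :
    g.IsSelfDual := by
  intro x
  obtain ⟨u, v, h⟩ := g.exists_isUnitaryFrame x
  exact h.weylMinus_eq_zero
    (h.isScalarOnMinus fun _ _ _ h' => h'.chernForm_eq_zero hβ (hconst x))
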